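/- Let $k$ be a finite field with $q$ elements, $K$ a finite extension of $k(t)$, and $R$ the integral closure of $k[t]$ in $K$. Let $E$ be the additive group $\mathbf{G}_{a,R}$ with the action of $k[t]$ given by a $k$-algebra homomorphism $\varphi\colon k[t]\to \mathrm{End}(\mathbf{G}_{a,R})$, $\varphi(t)=t+a_1\tau+\cdots+a_n\tau^n$, where $n\ge 0$, $a_i\in R$, $a_n\neq 0$ if $n>0$, and $\tau$ is the $q$-th power Frobenius. For an $R$-algebra $B$ let $E(B)$ be the additive group of $B$ with the $k[t]$-module structure given by $\varphi$, and let $\mathrm{Lie}_E(B)=B$ with its usual $k[t]$-module structure. Let $k((t^{-1}))$ be the completion of $k(t)$ at the place $t=\infty$, let $k((t^{-1}))^{\mathrm{sep}}$ be a separable closure of it with Galois group $G$, and put $K_\infty=K\otimes_{k(t)}k((t^{-1}))$ and $K_\infty^{\mathrm{sep}}=K\otimes_{k(t)}k((t^{-1}))^{\mathrm{sep}}$. Let $\exp_E(X)=\sum_{i\ge 0}e_iX^{q^i}\in K[[X]]$ be the unique such power series with $e_0=1$ and $\varphi(t)\exp_E(X)=\exp_E(tX)$, and let $\Lambda_E$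 be the kernel of $\exp_E$ on $\mathrm{Lie}_E(K_\infty^{\mathrm{sep}})$. Then there is a unique $k[t]$-linear map $\delta\colon E(K_\infty)\to \mathrm{H}^1(G,\Lambda_E)$ (the connecting homomorphism) such that, whenever $x\in E(K_\infty)$ and $y\in \mathrm{Lie}_E(K_\infty^{\mathrm{sep}})$ satisfy $\exp_E(y)=x$, the class $\delta(x)$ is represented by the continuous cocycle $\sigma\mapsto\sigma(y)-y$. The kernel $U_R$ of the composition $E(R)\to E(K_\infty)\xrightarrow{\delta}\mathrm{H}^1(G,\Lambda_E)$ is a finitely generated $k[t]$-module. Moreover, as a submodule of $E(K_\infty)$, $U_R$ is the image under $\exp_E$ of the $k[t]$-submodule $\exp_E^{-1}(E(R))\subset\mathrm{Lie}_E(K_\infty)$, and $\exp_E^{-1}(E(R))$ is discrete and co-compact in $\mathrm{Lie}_E(K_\infty)$. -/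

import Mathlib

open Polynomial TensorProduct

noncomputable section

namespace DrinfeldUnit

/-! ## The local field `k((1/t))` and its algebraic extensions -/

section LocalField

variable (k : Type*) [Field k]

open Classical in
/-- The field `k((1/t))`, i.e. the completion of `k(t)` at the place `∞`. -/
abbrev LocalInfty : Type _ := RatFunc.CompletionAtInfty k

/-- The valuation of `k((1/t))` at `∞`, normalised to an absolute value with `|t| = 2`
(only the topology that it induces is used). -/
instance rankOneLocalInfty :
    Valuation.RankOne (Valued.v : Valuation (LocalInfty k) (WithZero (Multiplicative ℤ))) where
  hom' := (WithZeroMulInt.toNNReal (e := 2) two_ne_zero).comp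
    MonoidWithZeroHom.ValueGroup₀.embedding
  strictMono' := (WithZeroMulInt.toNNReal_strictMono one_lt_two).comp
    MonoidWithZeroHom.ValueGroup₀.embedding_strictMono
  exists_val_nontrivial := by
    classical
    refine ⟨algebraMap (RatFunc k) (LocalInfty k) RatFunc.X, ?_⟩
    have h : (Valued.v : Valuation (LocalInfty k) (WithZero (Multiplicative ℤ)))
        (algebraMap (RatFunc k) (LocalInfty k) RatFunc.X) = WithZero.exp 1 :=
      (@Valued.valuedCompletion_apply _ _ _ _ (RatFunc.inftyValued k) RatFunc.X).trans
        (RatFunc.inftyValuation.X k)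
    rw [h]
    simp

instance normedLocalInfty : NontriviallyNormedField (LocalInfty k) :=
  Valued.toNontriviallyNormedField (LocalInfty k) (WithZero (Multiplicative ℤ))

instance ultraLocalInfty : IsUltrametricDist (LocalInfty k) :=
  Valued.instIsUltrametricDist (LocalInfty k) (WithZero (Multiplicative ℤ))

instance completeLocalInfty : CompleteSpace (LocalInfty k) := by
  classical
  exact @UniformSpace.Completion.completeSpace (RatFunc k) (RatFunc.inftyValued k).toUniformSpace

end LocalField

set_option linter.unusedSectionVars false

/-! ## Scalar extensions `K ⊗ L` for `L` algebraic over `k((1/t))` -/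

section ScalarExtension

variable (k K L : Type*) [Field k] [Field K] [Field L] [Algebra (RatFunc k) K]
  [Algebra (LocalInfty k) L] [Algebra.IsAlgebraic (LocalInfty k) L]
  [Algebra (RatFunc k) L]

/-- The topology of an algebraic extension `L` of `k((1/t))`, given by the unique absolute value on
`L` extending the one of `k((1/t))`. -/
@[reducible] def localTopology : TopologicalSpace L :=
  letI := spectralNorm.normedField (LocalInfty k) L
  inferInstance

/-- The canonical topology of the free `L`-module of finite rank `K ⊗_{k(t)} L`: any `L`-linear
isomorphism with `L ^ d` is a homeomorphism. -/
instance scalarExtensionTopology : TopologicalSpace (K ⊗[RatFunc k] L) :=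
  letI := localTopology k L
  letI : Algebra L (K ⊗[RatFunc k] L) := Algebra.TensorProduct.rightAlgebra
  moduleTopology L (K ⊗[RatFunc k] L)

instance scalarExtensionTopologicalRing [FiniteDimensional (RatFunc k) K] :
    IsTopologicalRing (K ⊗[RatFunc k] L) := by
  let _ := spectralNorm.normedField (LocalInfty k) L
  let _ : Algebra L (K ⊗[RatFunc k] L) := Algebra.TensorProduct.rightAlgebra
  have : IsModuleTopology L (K ⊗[RatFunc k] L) := ⟨rfl⟩
  have : Module.Finite L (K ⊗[RatFunc k] L) :=
    Module.Finite.equiv (Algebra.TensorProduct.commRight (RatFunc k) L K).toLinearEquiv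
  exact IsModuleTopology.isTopologicalRing L _

variable {k L} [IsScalarTower (RatFunc k) (LocalInfty k) L]

/-- The action of `Gal(L / k((1/t)))` on `K ⊗_{k(t)} L` through the second factor. -/
def galAct (σ : Gal(L/LocalInfty k)) : K ⊗[RatFunc k] L →ₐ[K] K ⊗[RatFunc k] L :=
  Algebra.TensorProduct.map (AlgHom.id K K) ((σ : L →ₐ[LocalInfty k] L).restrictScalars (RatFunc k))

variable {K}

@[simp] lemma galAct_tmul (σ : Gal(L/LocalInfty k)) (x : K) (y : L) :
    galAct K σ (x ⊗ₜ y) = x ⊗ₜ σ y := rfl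

lemma galAct_one (x : K ⊗[RatFunc k] L) : galAct K (1 : Gal(L/LocalInfty k)) x = x := by
  induction x with
  | zero => simp
  | tmul x y => simp
  | add x y hx hy => rw [map_add, hx, hy]

lemma galAct_mul (σ τ : Gal(L/LocalInfty k)) (x : K ⊗[RatFunc k] L) :
    galAct K (σ * τ) x = galAct K σ (galAct K τ x) := by
  induction x with
  | zero => simp
  | tmul x y => simp
  | add x y hx hy => rw [map_add, hx, hy, map_add, map_add]

lemma continuous_galAct (σ : Gal(L/LocalInfty k)) :
    Continuous (galAct K σ : K ⊗[RatFunc k] L → K ⊗[RatFunc k] L) := by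
  let _ := spectralNorm.normedField (LocalInfty k) L
  let _ : Algebra L (K ⊗[RatFunc k] L) := Algebra.TensorProduct.rightAlgebra
  have : IsModuleTopology L (K ⊗[RatFunc k] L) := ⟨rfl⟩
  have := IsModuleTopology.toContinuousAdd L (K ⊗[RatFunc k] L)
  have hσ : Continuous (σ : L →+* L) := by
    refine AddMonoidHomClass.continuous_of_bound (σ : L →+* L) 1 fun x ↦ ?_
    rw [one_mul]
    exact (spectralNorm_eq_of_equiv σ x).symm.le
  let f : K ⊗[RatFunc k] L →ₛₗ[(σ : L →+* L)] K ⊗[RatFunc k] L :=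
    { toFun := galAct K σ
      map_add' := map_add _
      map_smul' := fun c x ↦ by
        rw [Algebra.smul_def, Algebra.smul_def, map_mul]
        rfl }
  exact IsModuleTopology.continuous_of_linearMapₛₗ hσ f

/-- The inclusion `K_∞ = K ⊗ k((1/t)) → K ⊗ L`. -/
def fromLocal (K L : Type*) [Field K] [Field L] [Algebra (RatFunc k) K]
    [Algebra (LocalInfty k) L] [Algebra (RatFunc k) L]
    [IsScalarTower (RatFunc k) (LocalInfty k) L] :
    K ⊗[RatFunc k] LocalInfty k →ₐ[K] K ⊗[RatFunc k] L :=
  Algebra.TensorProduct.map (AlgHom.id K K) (IsScalarTower.toAlgHom (RatFunc k) (LocalInfty k) L)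

end ScalarExtension

/-! ## Models of Drinfeld modules -/

section Drinfeld

variable (k R : Type*) [Field k] [CommRing R] [Algebra k[X] R]

/-- A model `E` over a `k[t]`-algebra `R` of a Drinfeld module: the
`k`-algebra homomorphism `φ : k[t] → End(𝔾_a)` with `φ(t) = t + a₁ τ + ⋯ + aₙ τⁿ`, `aₙ ≠ 0`. It is
given by the sequence of the coefficients `a₀ = t, a₁, …, aₙ, 0, 0, …`. -/
structure DrinfeldModel where
  /-- The rank `n`. -/
  rank : ℕ
  /-- The coefficient `a i` of `τ ^ i` in `φ(t)`. -/
  coeff : ℕ → R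
  coeff_zero : coeff 0 = algebraMap k[X] _ X
  coeff_rank_ne_zero : coeff rank ≠ 0
  coeff_eq_zero : ∀ i, rank < i → coeff i = 0

end Drinfeld

namespace DrinfeldModel

variable {k R : Type*} [Field k] [Fintype k] [CommRing R] [Algebra k[X] R]

section Frobenius

/-- The structure map `k → R → B` of an `R`-algebra `B`. -/
def constMap (k R B : Type*) [Field k] [CommRing R] [Algebra k[X] R] [CommRing B]
    [Algebra R B] : k →+* B :=
  (algebraMap R B).comp
    ((algebraMap k[X] R).comp C)

variable {B : Type*} [CommRing B]

lemma pow_card_constMap (f : k →+* B) (i : ℕ) (c : k) : f c ^ Fintype.card k ^ i = f c := by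
  rw [← map_pow, FiniteField.pow_card_pow]

lemma add_pow_card (f : k →+* B) (i : ℕ) (x y : B) :
    (x + y) ^ Fintype.card k ^ i = x ^ Fintype.card k ^ i + y ^ Fintype.card k ^ i := by
  let _ : Algebra k B := f.toAlgebra
  have h (b : B) : ((FiniteField.frobeniusAlgHom k B) ^ i : B →ₐ[k] B) b =
      b ^ Fintype.card k ^ i := by
    rw [AlgHom.coe_pow, FiniteField.coe_frobeniusAlgHom, pow_iterate]
  rw [← h, ← h, ← h, map_add]

lemma zero_pow_card (i : ℕ) : (0 : B) ^ Fintype.card k ^ i = 0 :=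
  zero_pow (pow_ne_zero _ Fintype.card_ne_zero)

end Frobenius

variable (E : DrinfeldModel k R)

section Points

variable (B : Type*) [CommRing B] [Algebra R B]

/-- The action `b ↦ ∑ aᵢ b ^ (q ^ i)` of `φ(t)` on the additive group of an `R`-algebra `B`. -/
def tAct : B →+ B where
  toFun b := ∑ i ∈ Finset.range (E.rank + 1),
    algebraMap R B (E.coeff i) * b ^ Fintype.card k ^ i
  map_zero' := by simp
  map_add' x y := by
    simp [add_pow_card (constMap k R B), mul_add, Finset.sum_add_distrib]

lemma tAct_apply (b : B) : E.tAct B b = ∑ i ∈ Finset.range (E.rank + 1),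
    algebraMap R B (E.coeff i) * b ^ Fintype.card k ^ i := rfl

/-- The action of `k[t]` on the additive group of `B` which is given by `φ`. -/
def polyAct : k[X] →+* AddMonoid.End B :=
  eval₂RingHom' ((Module.toAddMonoidEnd B B).comp (constMap k R B)) (E.tAct B) fun c ↦ by
    refine AddMonoidHom.ext fun b ↦ ?_
    change constMap k R B c * E.tAct B b = E.tAct B (constMap k R B c * b)
    rw [tAct_apply, tAct_apply, Finset.mul_sum]
    refine Finset.sum_congr rfl fun i _ ↦ ?_
    rw [mul_pow, pow_card_constMap]
    ring

/-- The `k[t]`-module `E(B)` of `B`-rational points: the additive group of `B`, on which `k[t]` acts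
through `φ`. -/
def Points (_E : DrinfeldModel k R) (B : Type*) : Type _ := B

instance : AddCommGroup (E.Points B) := inferInstanceAs (AddCommGroup B)

instance : Module k[X] (E.Points B) := Module.compHom B (E.polyAct B)

variable {B}

/-- The identification of the additive groups `B` and `E(B)`. -/
def toPoints : B ≃+ E.Points B := AddEquiv.refl B

lemma C_smul_toPoints (c : k) (b : B) :
    (C c : k[X]) • E.toPoints b = E.toPoints (constMap k R B c * b) := by
  change E.polyAct B (C c) b = _
  have h : E.polyAct B (C c) = Module.toAddMonoidEnd B B (constMap k R B c) := eval₂_C _ _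
  rw [h]
  rfl

lemma X_smul_toPoints (b : B) : (X : k[X]) • E.toPoints b = E.toPoints (E.tAct B b) := by
  change E.polyAct B X b = _
  have h : E.polyAct B X = E.tAct B := eval₂_X _ _
  rw [h]
  rfl

/-- An additive predicate on a `k[t]`-module which is stable under constants and `t` is stable
under `k[t]`. -/
lemma smul_induction {M : Type*} [AddCommGroup M] [Module k[X] M] (P : M → Prop)
    (hadd : ∀ x y, P x → P y → P (x + y)) (hC : ∀ (c : k) x, P x → P ((C c : k[X]) • x))
    (hX : ∀ x, P x → P ((X : k[X]) • x)) (p : k[X]) (x : M) (hx : P x) : P (p • x) := by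
  induction p using Polynomial.induction_on' with
  | add p r hp hr => rw [add_smul]; exact hadd _ _ hp hr
  | monomial n c =>
    rw [← C_mul_X_pow_eq_monomial, mul_smul]
    refine hC _ _ ?_
    induction n with
    | zero => simpa
    | succ n ih => rw [pow_succ', mul_smul]; exact hX _ ih

/-- The map `E(B) → E(B')` induced by a homomorphism `B → B'` of `R`-algebras. -/
def pointsMap {B' : Type*} [CommRing B'] [Algebra R B']
    (f : B →ₐ[R] B') : E.Points B →ₗ[k[X]] E.Points B' where
  toFun b := E.toPoints (f (E.toPoints.symm b))
  map_add' x y := by simp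
  map_smul' p x := by
    refine smul_induction (M := E.Points B × E.Points B')
      (fun z ↦ E.toPoints (f (E.toPoints.symm z.1)) = z.2)
      ?_ ?_ ?_ p (x, E.toPoints (f (E.toPoints.symm x))) rfl
    · intro z w hz hw
      simp [← hz, ← hw]
    · intro c z hz
      obtain ⟨b, hb⟩ := E.toPoints.surjective z.1
      simp only [Prod.smul_fst, Prod.smul_snd]
      rw [← hz, ← hb, C_smul_toPoints, C_smul_toPoints]
      simp [constMap]
    · intro z hz
      obtain ⟨b, hb⟩ := E.toPoints.surjective z.1
      simp only [Prod.smul_fst, Prod.smul_snd]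
      rw [← hz, ← hb, X_smul_toPoints, X_smul_toPoints]
      simp [tAct_apply]

end Points

/-! ## The exponential -/

section Exponential

variable (K : Type*) [Field K] [Algebra k[X] K] [Algebra R K] [IsScalarTower k[X] R K]

/-- The coefficients `e_i` of `exp_E(Z) = ∑ e_i Z ^ (q ^ i)`: `e_0 = 1`, and the other ones are
determined by `φ(t) exp_E(Z) = exp_E(t Z)`, see `expCoeff_functional_equation`. -/
def expCoeff : ℕ → K
  | 0 => 1
  | i + 1 => (algebraMap k[X] K X ^ Fintype.card k ^ (i + 1) - algebraMap k[X] K X)⁻¹ *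
      ∑ j : Fin (i + 1), algebraMap R K (E.coeff (j + 1)) * expCoeff (i - j) ^ Fintype.card k ^ (j + 1 : ℕ)
  decreasing_by omega

/-- Comparison of the coefficients of `Z ^ (q ^ i)` in `φ(t) exp_E(Z) = exp_E(t Z)`. -/
lemma expCoeff_functional_equation [Algebra (RatFunc k) K] [IsScalarTower k[X] (RatFunc k) K]
    (i : ℕ) :
    ∑ j ∈ Finset.range (i + 1), algebraMap R K (E.coeff j) * E.expCoeff K (i - j) ^ Fintype.card k ^ j =
      E.expCoeff K i * algebraMap k[X] K X ^ Fintype.card k ^ i := by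
  have h0 : algebraMap R K (E.coeff 0) = algebraMap k[X] K X := by rw [E.coeff_zero, ← IsScalarTower.algebraMap_apply]
  cases i with
  | zero => simp [h0, mul_comm]
  | succ i =>
    have ht : algebraMap k[X] K X ^ Fintype.card k ^ (i + 1) - algebraMap k[X] K X ≠ 0 := by
      rw [← map_pow, ← map_sub, map_ne_zero_iff _ (FunctionField.algebraMap_injective k K),
        sub_ne_zero]
      intro h
      have h1 := congrArg natDegree h
      rw [natDegree_X_pow, natDegree_X] at h1
      exact (Nat.one_lt_pow i.succ_ne_zero Fintype.one_lt_card).ne' h1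
    rw [Finset.sum_range_succ', Finset.sum_range]
    have h2 : ∑ j : Fin (i + 1),
        algebraMap R K (E.coeff (j + 1)) * E.expCoeff K (i + 1 - (j + 1)) ^ Fintype.card k ^ (j + 1 : ℕ) =
        (algebraMap k[X] K X ^ Fintype.card k ^ (i + 1) - algebraMap k[X] K X) *
          E.expCoeff K (i + 1) := by
      rw [expCoeff, mul_inv_cancel_left₀ ht]
      refine Finset.sum_congr rfl fun j _ ↦ ?_
      rw [Nat.add_sub_add_right]
    rw [h2, h0]
    simp only [pow_zero, pow_one, Nat.sub_zero]
    ring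

variable [Algebra (RatFunc k) K] [IsScalarTower k[X] (RatFunc k) K]
variable {B : Type*} [CommRing B] [Algebra K B] [TopologicalSpace B]

/-- The series `exp_E(x) = ∑ e_i x ^ (q ^ i)` converges in `B` to `y`. -/
def HasExp (x y : B) : Prop :=
  HasSum (fun i ↦ algebraMap K B (E.expCoeff K i) * x ^ Fintype.card k ^ i) y

variable [IsTopologicalRing B] [Algebra R B]
  [IsScalarTower R K B] [Algebra k[X] B] [IsScalarTower k[X] K B]

variable {E K}

lemma HasExp.zero : E.HasExp K (0 : B) 0 := by
  simp [HasExp]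

lemma HasExp.add {x x' y y' : B} (h : E.HasExp K x y) (h' : E.HasExp K x' y') :
    E.HasExp K (x + x') (y + y') := by
  unfold HasExp at *
  simpa only [add_pow_card (constMap k R B), mul_add] using HasSum.add h h'

lemma HasExp.const_mul {x y : B} (h : E.HasExp K x y) (c : k) :
    E.HasExp K (constMap k R B c * x) (constMap k R B c * y) := by
  unfold HasExp at *
  simpa only [mul_pow, pow_card_constMap, mul_left_comm] using HasSum.mul_left (constMap k R B c) h

/-- The functional equation `exp_E(t x) = φ(t)(exp_E(x))`. -/
lemma HasExp.t_mul {x y : B} (h : E.HasExp K x y) :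
    E.HasExp K (algebraMap k[X] B X * x) (E.tAct B y) := by
  let u : ℕ → B := fun m ↦ algebraMap K B (E.expCoeff K m) * x ^ Fintype.card k ^ m
  let a : ℕ → B := fun j ↦ algebraMap R B (E.coeff j)
  let w : ℕ → ℕ → B := fun j i ↦ if j ≤ i then a j * u (i - j) ^ Fintype.card k ^ j else 0
  have hw (j : ℕ) : HasSum (w j) (a j * y ^ Fintype.card k ^ j) := by
    let φ : B →+ B := AddMonoidHom.mk' (fun b ↦ b ^ Fintype.card k ^ j)
      (add_pow_card (constMap k R B) j)
    have h1 : HasSum (fun m ↦ u m ^ Fintype.card k ^ j) (y ^ Fintype.card k ^ j) :=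
      HasSum.map h φ (continuous_pow _)
    have h2 := h1.mul_left (a j)
    rw [← (add_left_injective j).hasSum_iff]
    · refine h2.congr_fun fun m ↦ ?_
      simp [w]
    · intro i hi
      refine if_neg fun hji ↦ hi ⟨i - j, ?_⟩
      exact Nat.sub_add_cancel hji
  have hs := hasSum_sum fun j (_ : j ∈ Finset.range (E.rank + 1)) ↦ hw j
  have hy : ∑ j ∈ Finset.range (E.rank + 1), a j * y ^ Fintype.card k ^ j = E.tAct B y := by
    rw [tAct_apply]
  rw [hy] at hs
  refine hs.congr_fun fun i ↦ ?_
  have h3 : ∑ j ∈ Finset.range (E.rank + 1), w j i = ∑ j ∈ Finset.range (i + 1), w j i := by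
    have h5 : ∑ j ∈ Finset.range (E.rank + 1 + i), w j i =
        ∑ j ∈ Finset.range (E.rank + 1), w j i := by
      refine (Finset.sum_subset (Finset.range_mono (by omega)) fun j _ hj ↦ ?_).symm
      have h6 : a j = 0 := by
        simp only [a]
        rw [E.coeff_eq_zero j (by simpa using hj)]
        simp
      simp [w, h6]
    have h7 : ∑ j ∈ Finset.range (E.rank + 1 + i), w j i =
        ∑ j ∈ Finset.range (i + 1), w j i := by
      refine (Finset.sum_subset (Finset.range_mono (by omega)) fun j _ hj ↦ ?_).symm
      have h6 : ¬ j ≤ i := fun h ↦ hj (Finset.mem_range.mpr (Nat.lt_succ_of_le h))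
      simp [w, h6]
    rw [← h5, h7]
  rw [h3, mul_pow, IsScalarTower.algebraMap_apply k[X] K B, ← map_pow, ← mul_assoc, ← map_mul,
    ← E.expCoeff_functional_equation K i, map_sum, Finset.sum_mul]
  refine Finset.sum_congr rfl fun j hj ↦ ?_
  have hji : j ≤ i := Nat.lt_succ_iff.mp (Finset.mem_range.mp hj)
  simp only [w, if_pos hji, a, u]
  rw [IsScalarTower.algebraMap_apply R K B, mul_pow, ← pow_mul, ← pow_add, Nat.sub_add_cancel hji, map_mul, map_pow, mul_assoc]

variable (E) (K B)

/-- The graph of the homomorphism of `k[t]`-modules `exp_E : Lie_E(B) → E(B)`, where `Lie_E(B) = B`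
with its usual structure of `k[t]`-module. -/
def expGraph : Submodule k[X] (B × E.Points B) where
  carrier := {z | E.HasExp K z.1 (E.toPoints.symm z.2)}
  zero_mem' := HasExp.zero
  add_mem' h h' := HasExp.add h h'
  smul_mem' p z hz := by
    refine smul_induction (M := B × E.Points B) (fun z ↦ E.HasExp K z.1 (E.toPoints.symm z.2))
      (fun z w hz hw ↦ HasExp.add (R := R) hz hw) (fun c z hz ↦ ?_) (fun z hz ↦ ?_) p z hz
    · have h := HasExp.const_mul hz c
      have h1 : (C c : k[X]) • z.1 = constMap k R B c * z.1 := by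
        rw [Algebra.smul_def, IsScalarTower.algebraMap_apply k[X] K B,
          IsScalarTower.algebraMap_apply k[X] R K, ← IsScalarTower.algebraMap_apply R K B]
        rfl
      have h2 := E.C_smul_toPoints c (E.toPoints.symm z.2)
      rw [AddEquiv.apply_symm_apply] at h2
      rw [Prod.smul_fst, Prod.smul_snd, h1, h2, AddEquiv.symm_apply_apply]
      exact h
    · have h := HasExp.t_mul hz
      have h2 := E.X_smul_toPoints (E.toPoints.symm z.2)
      rw [AddEquiv.apply_symm_apply] at h2
      rw [Prod.smul_fst, Prod.smul_snd, Algebra.smul_def, h2, AddEquiv.symm_apply_apply]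
      exact h

/-- The kernel of `exp_E : Lie_E(B) → E(B)`. -/
def expKer : Submodule k[X] B := (E.expGraph K B).comap (LinearMap.inl k[X] B (E.Points B))

/-- The inverse image in `Lie_E(B)` of a submodule of `E(B)` under `exp_E`. -/
def expPreimage (N : Submodule k[X] (E.Points B)) : Submodule k[X] B :=
  (E.expGraph K B ⊓ N.comap (LinearMap.snd k[X] B (E.Points B))).map
    (LinearMap.fst k[X] B (E.Points B))

/-- The image in `E(B)` of a submodule of `Lie_E(B)` under `exp_E`. -/
def expImage (M : Submodule k[X] B) : Submodule k[X] (E.Points B) :=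
  (E.expGraph K B ⊓ M.comap (LinearMap.fst k[X] B (E.Points B))).map
    (LinearMap.snd k[X] B (E.Points B))

variable {B}

lemma mem_expKer {x : B} : x ∈ E.expKer K B ↔ E.HasExp K x 0 := Iff.rfl

lemma mem_expPreimage {N : Submodule k[X] (E.Points B)} {x : B} :
    x ∈ E.expPreimage K B N ↔ ∃ y, E.HasExp K x y ∧ E.toPoints y ∈ N := by
  constructor
  · rintro ⟨⟨x, y⟩, h, rfl⟩
    exact ⟨E.toPoints.symm y, h.1, h.2⟩
  · rintro ⟨y, h⟩
    exact ⟨(x, E.toPoints y), h, rfl⟩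

lemma mem_expImage {M : Submodule k[X] B} {y : B} :
    E.toPoints y ∈ E.expImage K B M ↔ ∃ x ∈ M, E.HasExp K x y := by
  constructor
  · rintro ⟨⟨x, y⟩, h, rfl⟩
    exact ⟨x, h.2, h.1⟩
  · rintro ⟨x, h⟩
    exact ⟨(x, E.toPoints y), h.symm, rfl⟩

end Exponential

end DrinfeldModel

/-! ## Continuous group cohomology in degree one -/

section Cohomology

variable (A G M : Type*) [CommRing A] [Group G] [TopologicalSpace G] [AddCommGroup M]
  [TopologicalSpace M] [IsTopologicalAddGroup M] [Module A M] [ContinuousConstSMul A M]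
  [DistribMulAction G M] [SMulCommClass G A M]

/-- The continuous crossed homomorphisms `G → M`. -/
def contCocycles₁ : Submodule A (G → M) where
  carrier := {c | Continuous c ∧ ∀ g h, c (g * h) = c g + g • c h}
  zero_mem' := ⟨continuous_const, fun _ _ ↦ by simp⟩
  add_mem' := fun {c d} hc hd ↦ ⟨hc.1.add hd.1, fun g h ↦ by
    simp only [Pi.add_apply, hc.2, hd.2, smul_add]; abel⟩
  smul_mem' := fun a c hc ↦ ⟨hc.1.const_smul a, fun g h ↦ by
    simp only [Pi.smul_apply, hc.2, smul_add, smul_comm g a]⟩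

/-- The crossed homomorphisms of the form `g ↦ g m - m`. -/
def contCoboundaries₁ : Submodule A (contCocycles₁ A G M) where
  carrier := {c | ∃ m : M, ∀ g, c.1 g = g • m - m}
  zero_mem' := ⟨0, fun _ ↦ by simp⟩
  add_mem' := by
    rintro c d ⟨m, hm⟩ ⟨n, hn⟩
    refine ⟨m + n, fun g ↦ ?_⟩
    simp only [Submodule.coe_add, Pi.add_apply, hm, hn, smul_add]
    abel
  smul_mem' := by
    rintro a c ⟨m, hm⟩
    refine ⟨a • m, fun g ↦ ?_⟩
    simp only [Submodule.coe_smul, Pi.smul_apply, hm, smul_sub, smul_comm g a]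

/-- The continuous cohomology `H¹(G, M)`. -/
abbrev ContH1 : Type _ := contCocycles₁ A G M ⧸ contCoboundaries₁ A G M

end Cohomology

/-! ## The lattice `Λ_E` and the connecting homomorphism -/

namespace DrinfeldModel

variable {k R : Type*} [Field k] [Fintype k] [CommRing R] [Algebra k[X] R]
  (E : DrinfeldModel k R)
  (K : Type*) [Field K] [Algebra k[X] K] [Algebra (RatFunc k) K] [IsScalarTower k[X] (RatFunc k) K]
  [FiniteDimensional (RatFunc k) K] [Algebra R K] [IsScalarTower k[X] R K]
  (L : Type*) [Field L] [Algebra (LocalInfty k) L] [Algebra.IsAlgebraic (LocalInfty k) L]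
  [Algebra (RatFunc k) L] [IsScalarTower (RatFunc k) (LocalInfty k) L]

/-- The kernel of `exp_E` on `Lie_E(K ⊗ L)`; it is `Λ_E` if `L` is a separable closure of
`k((1/t))`. -/
def periodLattice : Submodule k[X] (K ⊗[RatFunc k] L) := E.expKer K (K ⊗[RatFunc k] L)

variable {K L} in
lemma HasExp.map_galAct {x y : K ⊗[RatFunc k] L} (h : E.HasExp K x y) (σ : Gal(L/LocalInfty k)) :
    E.HasExp K (galAct K σ x) (galAct K σ y) := by
  have h1 := HasSum.map h (galAct K σ) (continuous_galAct σ)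
  refine h1.congr_fun fun i ↦ ?_
  simp

/-- The action of `Gal(L / k((1/t)))` on the kernel of `exp_E`. -/
instance : DistribMulAction Gal(L/LocalInfty k) (E.periodLattice K L) where
  smul σ x := ⟨galAct K σ x, by
    have h : E.HasExp K (galAct K σ x) (galAct K σ 0) :=
      HasExp.map_galAct E ((E.mem_expKer K).mp x.2) σ
    rw [map_zero] at h
    exact h⟩
  one_smul x := Subtype.ext (galAct_one _)
  mul_smul σ τ x := Subtype.ext (galAct_mul σ τ _)
  smul_zero σ := Subtype.ext (map_zero _)
  smul_add σ x y := Subtype.ext (map_add _ _ _)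

lemma coe_gal_smul (σ : Gal(L/LocalInfty k)) (x : E.periodLattice K L) :
    ((σ • x : E.periodLattice K L) : K ⊗[RatFunc k] L) = galAct K σ x := rfl

instance : SMulCommClass Gal(L/LocalInfty k) k[X] (E.periodLattice K L) where
  smul_comm σ p x := Subtype.ext <| by
    rw [coe_gal_smul, Submodule.coe_smul, Submodule.coe_smul, coe_gal_smul,
      ← IsScalarTower.algebraMap_smul K p (x : K ⊗[RatFunc k] L), map_smul,
      IsScalarTower.algebraMap_smul]

instance : ContinuousConstSMul k[X] (E.periodLattice K L) where
  continuous_const_smul p := by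
    refine Continuous.subtype_mk (f := fun x : E.periodLattice K L ↦ p • (x : K ⊗[RatFunc k] L))
      ?_ _
    simp only [Algebra.smul_def]
    exact continuous_const.mul continuous_subtype_val

/-- The `k[t]`-module `H¹(G, Λ_E)` for `G = Gal(L / k((1/t)))`. -/
abbrev H1 : Type _ := ContH1 k[X] Gal(L/LocalInfty k) (E.periodLattice K L)

variable {K L}

/-- The map `δ` is the connecting homomorphism `E(K_∞) → H¹(G, Λ_E)` of the exact sequence
`0 → Λ_E → Lie_E(K ⊗ L) → E(K ⊗ L) → 0`: for any `y` with `exp_E(y) = x`, the class `δ(x)` is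
represented by the cocycle `σ ↦ σ(y) - y`. -/
def IsConnectingHom
    (δ : E.Points (K ⊗[RatFunc k] LocalInfty k) →ₗ[k[X]] E.H1 K L) : Prop :=
  ∀ (x : K ⊗[RatFunc k] LocalInfty k) (y : K ⊗[RatFunc k] L), E.HasExp K y (fromLocal K L x) →
    ∃ c : contCocycles₁ k[X] Gal(L/LocalInfty k) (E.periodLattice K L),
      (∀ σ, (c.1 σ : K ⊗[RatFunc k] L) = galAct K σ y - y) ∧
      δ (E.toPoints x) = Submodule.Quotient.mk c

variable (K)

/-- The inclusion `E(R) → E(K_∞)`. -/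
def integralPoints : E.Points R →ₗ[k[X]] E.Points (K ⊗[RatFunc k] LocalInfty k) :=
  E.pointsMap (Algebra.ofId R (K ⊗[RatFunc k] LocalInfty k))

/-- The inverse image `exp_E⁻¹(E(R))` in `Lie_E(K_∞) = K_∞`. -/
def unitLattice : Submodule k[X] (K ⊗[RatFunc k] LocalInfty k) :=
  E.expPreimage K (K ⊗[RatFunc k] LocalInfty k) (LinearMap.range (E.integralPoints K))

variable {K}

/-- The kernel `U_R` of the composition of `E(R) → E(K_∞)` with `δ : E(K_∞) → H¹(G, Λ_E)`. -/
def unitModule (δ : E.Points (K ⊗[RatFunc k] LocalInfty k) →ₗ[k[X]] E.H1 K L) :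
    Submodule k[X] (E.Points R) :=
  LinearMap.ker (δ ∘ₗ E.integralPoints K)

end DrinfeldModel

end DrinfeldUnit

end

/-!
Write `A = K ⊗ L` for the scalar extension to the separable closure `L` of `k((1/t))`, and
`K_∞ = K ⊗ k((1/t))`.

**The exponential is entire and a local homeomorphism.** The recursion formula for the coefficients
`eᵢ` yields a bound `‖eᵢ‖ ≤ (C ρ ^ i) ^ (q ^ i)` with `ρ < 1` (`exists_norm_expCoeff_le`), because
`t ^ (q ^ i) - t` is large. Hence in every complete normed algebra over `k((1/t))` the series
converges everywhere, and it is a perturbation of the identity near `0`, with a radius that depends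
on `C` only (`exists_addMonoidHom_hasSum`). As an algebra of finite dimension over `k((1/t))` is
normable, this applies to `K_∞` (`exists_isExpOn`).

**The exponential is surjective on `A`.** Let first `M` be a separably closed algebraic extension
of `k((1/t))`. A long truncation of `exp_E(y) = x` is a separable polynomial equation; its smallest
root satisfies `|y| ≤ |x|`, as the sum of the inverses of the roots is `1 / x`. So the tail of the
series at `y` is small, and it is absorbed by the local inverse of `exp_E` in a complete subfield
of finite degree (`exists_hasExp_eq_of_isSepClosed`). The ring `A` is Artinian, with residue fields
that are separably closed because they are algebraic over `L`. Solutions in the residue fields are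
combined by the Chinese remainder theorem, and the remaining error is nilpotent; on nilpotent
elements `exp_E` is a finite sum that is inverted step by step (`exists_hasExp_eq`). No
separability of `K` over `k(t)` is needed here.

**The connecting homomorphism.** By surjectivity the cocycles `σ ↦ σ(y) - y` define `δ`, and
determine it. If the class of `x = exp_E(y)` vanishes, then `y` becomes Galois invariant after
subtracting a period, so that it lies in `K_∞` by Galois descent. Therefore the kernel of `δ` is the
image of `exp_E` on `K_∞` (`isConnectingHom_eq_zero_iff`).

**The lattice.** The ring `R` is a finite `k[t]`-module: this is reduced to the separable case by a
power of the Frobenius, which is finite on `k[t]` (`finite_integralClosure`). Thus `R` is discrete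
and co-compact in `K_∞`. Since `exp_E` is continuous, open and injective near `0`, the inverse
image of `R` is discrete and co-compact as well (`discreteTopology_unitLattice`,
`compactSpace_quotient_unitLattice`). A discrete and co-compact `k[t]`-submodule is finitely
generated (`fg_of_discreteTopology`), and so is its image `U_R` under `exp_E`.
-/

noncomputable section

namespace DrinfeldUnit

/-! ### The local field `k((1/t))` -/

section LocalFieldFacts

variable (k : Type*) [Field k]

lemma norm_eq_toNNReal_valuation (x : LocalInfty k) :
    ‖x‖ = WithZeroMulInt.toNNReal (e := 2) two_ne_zero (Valued.v x) := by
  change ((WithZeroMulInt.toNNReal (e := 2) two_ne_zero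
    (MonoidWithZeroHom.ValueGroup₀.embedding (Valued.v.restrict x)) : NNReal) : ℝ) = _
  rw [Valuation.embedding_restrict]

lemma norm_algebraMap_ratFunc {r : RatFunc k} (hr : r ≠ 0) :
    ‖algebraMap (RatFunc k) (LocalInfty k) r‖ = 2 ^ r.intDegree := by
  classical
  have h : (Valued.v : Valuation (LocalInfty k) (WithZero (Multiplicative ℤ)))
      (algebraMap (RatFunc k) (LocalInfty k) r) = WithZero.exp r.intDegree :=
    (@Valued.valuedCompletion_apply _ _ _ _ (RatFunc.inftyValued k) r).trans
      (RatFunc.inftyValuation_of_nonzero k hr)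
  rw [norm_eq_toNNReal_valuation, h, WithZeroMulInt.toNNReal_neg_apply _ (by simp)]
  simp [WithZero.exp]

lemma norm_algebraMap_X : ‖algebraMap (RatFunc k) (LocalInfty k) RatFunc.X‖ = 2 := by
  rw [norm_algebraMap_ratFunc k RatFunc.X_ne_zero, RatFunc.intDegree_X, zpow_one]

/-- The image of a polynomial in `k((1/t))`. -/
def polyToLocal : k[X] →+* LocalInfty k :=
  (algebraMap (RatFunc k) (LocalInfty k)).comp (algebraMap k[X] (RatFunc k))

variable {k}

lemma norm_polyToLocal {p : k[X]} (hp : p ≠ 0) : ‖polyToLocal k p‖ = 2 ^ p.natDegree := by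
  have h : algebraMap k[X] (RatFunc k) p ≠ 0 := by simpa using hp
  rw [polyToLocal, RingHom.comp_apply, norm_algebraMap_ratFunc k h, RatFunc.intDegree_polynomial,
    zpow_natCast]

lemma polyToLocal_X : polyToLocal k X = algebraMap (RatFunc k) (LocalInfty k) RatFunc.X := by
  simp [polyToLocal]

lemma norm_polyToLocal_X : ‖polyToLocal k X‖ = 2 := by
  rw [polyToLocal_X, norm_algebraMap_X]

lemma eq_zero_of_norm_polyToLocal_lt_one {p : k[X]} (hp : ‖polyToLocal k p‖ < 1) : p = 0 := by
  by_contra h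
  rw [norm_polyToLocal h] at hp
  exact hp.not_ge (one_le_pow₀ one_le_two)

lemma exists_eq_C_of_norm_polyToLocal_lt_two {p : k[X]} (hp : ‖polyToLocal k p‖ < 2) :
    ∃ c : k, p = C c := by
  by_cases h : p = 0
  · exact ⟨0, by simp [h]⟩
  rw [norm_polyToLocal h] at hp
  refine ⟨p.coeff 0, eq_C_of_natDegree_eq_zero ?_⟩
  by_contra h0
  exact hp.not_ge (le_self_pow₀ one_le_two h0)

lemma denseRange_algebraMap_ratFunc : DenseRange (algebraMap (RatFunc k) (LocalInfty k)) := by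
  classical
  exact @UniformSpace.Completion.denseRange_coe (RatFunc k) (RatFunc.inftyValued k).toUniformSpace

/-- Every element of `k((1/t))` has a polynomial part. -/
lemma exists_norm_sub_polyToLocal_lt_one (x : LocalInfty k) :
    ∃ p : k[X], ‖x - polyToLocal k p‖ < 1 := by
  obtain ⟨r, hr⟩ := denseRange_algebraMap_ratFunc.exists_dist_lt x one_pos
  rw [dist_eq_norm] at hr
  refine ⟨r.num / r.denom, ?_⟩
  have hd : algebraMap k[X] (RatFunc k) r.denom ≠ 0 := by simpa using r.denom_ne_zero
  have h1 : r - algebraMap k[X] (RatFunc k) (r.num / r.denom) =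
      algebraMap k[X] (RatFunc k) (r.num % r.denom) / algebraMap k[X] (RatFunc k) r.denom := by
    rw [eq_div_iff hd, sub_mul, sub_eq_iff_eq_add, ← map_mul, ← map_add]
    have h0 : r * algebraMap k[X] (RatFunc k) r.denom = algebraMap k[X] (RatFunc k) r.num :=
      (div_eq_iff hd).mp r.num_div_denom |>.symm
    rw [h0, mul_comm, add_comm, EuclideanDomain.div_add_mod]
  have h2 : ‖algebraMap (RatFunc k) (LocalInfty k)
      (r - algebraMap k[X] (RatFunc k) (r.num / r.denom))‖ < 1 := by
    rw [h1, map_div₀, norm_div]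
    change ‖polyToLocal k _‖ / ‖polyToLocal k _‖ < 1
    have h0 : ‖polyToLocal k r.denom‖ = 2 ^ r.denom.natDegree := norm_polyToLocal r.denom_ne_zero
    by_cases hm : r.num % r.denom = 0
    · simp [hm]
    · rw [div_lt_one (by rw [h0]; positivity), h0, norm_polyToLocal hm]
      refine pow_lt_pow_right₀ one_lt_two (natDegree_lt_natDegree hm ?_)
      exact EuclideanDomain.mod_lt _ r.denom_ne_zero
  have h3 : x - polyToLocal k (r.num / r.denom) = (x - algebraMap (RatFunc k) (LocalInfty k) r) +
      algebraMap (RatFunc k) (LocalInfty k)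
        (r - algebraMap k[X] (RatFunc k) (r.num / r.denom)) := by
    rw [map_sub]
    exact (sub_add_sub_cancel _ _ _).symm
  rw [h3]
  exact (IsUltrametricDist.norm_add_le_max _ _).trans_lt (max_lt hr h2)

/-- The elements of absolute value less than `1` are expanded in powers of `1/t`, with digits in the
finite field `k`. -/
lemma totallyBounded_ball_localInfty [Finite k] :
    TotallyBounded (Metric.ball (0 : LocalInfty k) 1) := by
  let t : LocalInfty k := polyToLocal k X
  have ht : ‖t‖ = 2 := norm_polyToLocal_X
  have ht0 : t ≠ 0 := norm_ne_zero_iff.mp (by rw [ht]; exact two_ne_zero)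
  have key (n : ℕ) : ∃ T : Set (LocalInfty k), T.Finite ∧
      ∀ x : LocalInfty k, ‖x‖ < 1 → ∃ y ∈ T, ‖x - y‖ < (1 / 2) ^ n := by
    induction n with
    | zero => exact ⟨{0}, Set.finite_singleton 0, fun x hx ↦ ⟨0, rfl, by simpa using hx⟩⟩
    | succ n ih =>
      obtain ⟨T, hT, h⟩ := ih
      -- the next digit of the expansion in powers of `1/t`
      refine ⟨(fun z : LocalInfty k × k ↦ z.1 + polyToLocal k (C z.2) * t⁻¹ ^ (n + 1)) ''
        (T ×ˢ Set.univ), (hT.prod Set.finite_univ).image _, fun x hx ↦ ?_⟩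
      obtain ⟨y, hy, hxy⟩ := h x hx
      obtain ⟨p, hp⟩ := exists_norm_sub_polyToLocal_lt_one (t ^ (n + 1) * (x - y))
      have h1 : ‖t ^ (n + 1) * (x - y)‖ < 2 := by
        rw [norm_mul, norm_pow, ht]
        calc (2 : ℝ) ^ (n + 1) * ‖x - y‖ < 2 ^ (n + 1) * (1 / 2) ^ n := by gcongr
          _ = 2 := by rw [pow_succ, mul_right_comm, ← mul_pow]; norm_num
      have h2 : ‖polyToLocal k p‖ < 2 := by
        have h3 : polyToLocal k p =
            t ^ (n + 1) * (x - y) - (t ^ (n + 1) * (x - y) - polyToLocal k p) := by ring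
        rw [h3, sub_eq_add_neg]
        refine (IsUltrametricDist.norm_add_le_max _ _).trans_lt (max_lt h1 ?_)
        rw [norm_neg]
        exact hp.trans one_lt_two
      obtain ⟨c, rfl⟩ := exists_eq_C_of_norm_polyToLocal_lt_two h2
      refine ⟨_, ⟨(y, c), ⟨hy, Set.mem_univ _⟩, rfl⟩, ?_⟩
      have h4 : x - (y + polyToLocal k (C c) * t⁻¹ ^ (n + 1)) =
          t⁻¹ ^ (n + 1) * (t ^ (n + 1) * (x - y) - polyToLocal k (C c)) := by
        rw [mul_sub, ← mul_assoc, ← mul_pow, inv_mul_cancel₀ ht0, one_pow]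
        ring
      change ‖x - (y + polyToLocal k (C c) * t⁻¹ ^ (n + 1))‖ < _
      rw [h4, norm_mul, norm_pow, norm_inv, ht, ← one_div]
      exact mul_lt_of_lt_one_right (by positivity) hp
  refine Metric.totallyBounded_iff.mpr fun ε hε ↦ ?_
  obtain ⟨n, hn⟩ := exists_pow_lt_of_lt_one hε (show (1 / 2 : ℝ) < 1 by norm_num)
  obtain ⟨T, hT, h⟩ := key n
  refine ⟨T, hT, fun x hx ↦ ?_⟩
  obtain ⟨y, hy, hxy⟩ := h x (by simpa using hx)
  exact Set.mem_biUnion hy (by rw [Metric.mem_ball, dist_eq_norm]; exact hxy.trans hn)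

lemma isCompact_closure_ball_localInfty [Finite k] :
    IsCompact (closure (Metric.ball (0 : LocalInfty k) 1)) :=
  totallyBounded_ball_localInfty.closure.isCompact_of_isClosed isClosed_closure

instance [Finite k] : ProperSpace (LocalInfty k) := by
  have : LocallyCompactSpace (LocalInfty k) :=
    isCompact_closure_ball_localInfty.locallyCompactSpace_of_mem_nhds_of_addGroup (x := 0)
      (Filter.mem_of_superset (Metric.ball_mem_nhds 0 one_pos) subset_closure)
  exact ProperSpace.of_locallyCompactSpace (LocalInfty k)

end LocalFieldFacts

/-! ### Additive power series in complete normed rings -/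

section FrobeniusSeries

lemma summable_mul_pow_pow {q : ℕ} (hq : 2 ≤ q) {C ρ r : ℝ} (hC : 0 ≤ C) (hρ0 : 0 ≤ ρ) (hρ : ρ < 1)
    (hr : 0 ≤ r) : Summable fun i : ℕ ↦ (C * ρ ^ i * r) ^ q ^ i := by
  have h1 : Filter.Tendsto (fun i : ℕ ↦ C * ρ ^ i * r) Filter.atTop (nhds 0) := by
    simpa using ((tendsto_pow_atTop_nhds_zero_of_lt_one hρ0 hρ).const_mul C).mul_const r
  refine Summable.of_norm_bounded_eventually_nat
    (summable_geometric_of_lt_one (by norm_num) (show (1 / 2 : ℝ) < 1 by norm_num)) ?_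
  filter_upwards [h1.eventually_le_const (show (0 : ℝ) < 1 / 2 by norm_num)] with i hi
  have h0 : 0 ≤ C * ρ ^ i * r := by positivity
  rw [Real.norm_of_nonneg (pow_nonneg h0 _)]
  calc (C * ρ ^ i * r) ^ q ^ i ≤ (1 / 2) ^ q ^ i := pow_le_pow_left₀ h0 hi _
    _ ≤ (1 / 2) ^ i := pow_le_pow_of_le_one (by norm_num) (by norm_num)
      (Nat.lt_pow_self hq).le

variable {k B : Type*} [Field k] [Fintype k] [NormedCommRing B]

lemma norm_mul_pow_card_le {e : ℕ → B} {C ρ : ℝ}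
    (he : ∀ i, ‖e i‖ ≤ (C * ρ ^ i) ^ Fintype.card k ^ i) (x : B) (i : ℕ) :
    ‖e i * x ^ Fintype.card k ^ i‖ ≤ (C * ρ ^ i * ‖x‖) ^ Fintype.card k ^ i := by
  rw [mul_pow]
  have h0 := he i
  refine (norm_mul_le _ _).trans (mul_le_mul h0
    (norm_pow_le' _ (pow_pos Fintype.card_pos _)) (norm_nonneg _) ((norm_nonneg _).trans h0))

/-- An additive series `f(x) = ∑ eᵢ x ^ (q ^ i)` with `e₀ = 1` and rapidly decreasing coefficients
converges everywhere, and is bijective from small balls to small balls. The radius only depends on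
the bound for the coefficients. -/
theorem exists_addMonoidHom_hasSum [CompleteSpace B] (φ : k →+* B) {e : ℕ → B} (he0 : e 0 = 1)
    {C ρ : ℝ} (hC : 1 ≤ C) (hρ0 : 0 ≤ ρ) (hρ : ρ < 1)
    (he : ∀ i, ‖e i‖ ≤ (C * ρ ^ i) ^ Fintype.card k ^ i) :
    ∃ f : B →+ B, Continuous f ∧ (∀ x, HasSum (fun i ↦ e i * x ^ Fintype.card k ^ i) (f x)) ∧
      (∀ z, 4 * C ^ 2 * ‖z‖ ≤ 1 → ∃ w, f w = z ∧ ‖w‖ ≤ 2 * ‖z‖) ∧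
      (∀ w, 4 * C ^ 2 * ‖w‖ ≤ 1 → f w = 0 → w = 0) := by
  have hq : 2 ≤ Fintype.card k := Fintype.one_lt_card
  have hs (x : B) : Summable fun i ↦ e i * x ^ Fintype.card k ^ i :=
    Summable.of_norm_bounded (summable_mul_pow_pow hq (zero_le_one.trans hC) hρ0 hρ (norm_nonneg x))
      (norm_mul_pow_card_le he x)
  let f : B →+ B :=
    { toFun x := ∑' i, e i * x ^ Fintype.card k ^ i
      map_zero' := by simp
      map_add' x y := by
        rw [← (hs x).tsum_add (hs y)]
        simp only [DrinfeldModel.add_pow_card φ, mul_add] }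
  have hf (x : B) : HasSum (fun i ↦ e i * x ^ Fintype.card k ^ i) (f x) := (hs x).hasSum
  -- the difference of `f` and the identity is of second order
  have hg (x : B) (hx : 4 * C ^ 2 * ‖x‖ ≤ 1) : ‖f x - x‖ ≤ 1 / 2 * ‖x‖ := by
    have h0 : 0 ≤ C * ‖x‖ := by positivity
    have h1 : C * ‖x‖ ≤ 1 / 2 := by nlinarith [norm_nonneg x]
    have h2 : HasSum (fun i ↦ e (i + 1) * x ^ Fintype.card k ^ (i + 1)) (f x - x) := by
      have := (hasSum_nat_add_iff' 1).mpr (hf x)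
      simpa [he0] using this
    have h3 : HasSum (fun i : ℕ ↦ (C * ‖x‖) ^ 2 * (1 / 2 : ℝ) ^ i) ((C * ‖x‖) ^ 2 * 2) :=
      hasSum_geometric_two.mul_left _
    have h4 : ‖f x - x‖ ≤ (C * ‖x‖) ^ 2 * 2 := by
      refine h2.norm_le_of_bounded h3 fun i ↦ (norm_mul_pow_card_le he x _).trans ?_
      calc (C * ρ ^ (i + 1) * ‖x‖) ^ Fintype.card k ^ (i + 1)
          ≤ (C * ‖x‖) ^ Fintype.card k ^ (i + 1) := by
            refine pow_le_pow_left₀ (by positivity) ?_ _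
            gcongr
            exact mul_le_of_le_one_right (by positivity) (pow_le_one₀ hρ0 hρ.le)
        _ ≤ (C * ‖x‖) ^ (2 + i) := pow_le_pow_of_le_one h0 (h1.trans (by norm_num))
            (by have := Nat.lt_pow_self hq (n := i + 1); omega)
        _ ≤ (C * ‖x‖) ^ 2 * (1 / 2) ^ i := by rw [pow_add]; gcongr
    nlinarith [norm_nonneg x]
  have hfc : Continuous f := by
    refine continuous_of_continuousAt_zero f ?_
    rw [ContinuousAt, map_zero]
    have h1 : Filter.Tendsto (fun x : B ↦ 2 * ‖x‖) (nhds 0) (nhds 0) := by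
      simpa using (tendsto_norm_zero (E := B)).const_mul 2
    refine squeeze_zero_norm' ?_ h1
    have h2 : Filter.Tendsto (fun x : B ↦ 4 * C ^ 2 * ‖x‖) (nhds 0) (nhds 0) := by
      simpa using (tendsto_norm_zero (E := B)).const_mul (4 * C ^ 2)
    filter_upwards [h2.eventually_le_const one_pos] with x hx
    calc ‖f x‖ = ‖(f x - x) + x‖ := by rw [sub_add_cancel]
      _ ≤ ‖f x - x‖ + ‖x‖ := norm_add_le _ _
      _ ≤ 2 * ‖x‖ := by linarith [hg x hx, norm_nonneg x]
  refine ⟨f, hfc, hf, fun z hz ↦ ?_, fun w hw h0 ↦ ?_⟩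
  · -- the inverse is the geometric series of `1 - f`
    let u : ℕ → B := fun m ↦ (fun y ↦ y - f y)^[m] z
    have hu1 (m : ℕ) : u (m + 1) = u m - f (u m) := Function.iterate_succ_apply' _ _ _
    have hu (m : ℕ) : ‖u m‖ ≤ ‖z‖ * (1 / 2) ^ m := by
      induction m with
      | zero => simp [u]
      | succ m ih =>
        have h1 : ‖u m‖ ≤ ‖z‖ :=
          ih.trans (mul_le_of_le_one_right (norm_nonneg _)
            (pow_le_one₀ (by norm_num) (by norm_num)))
        have h2 := hg (u m) ((mul_le_mul_of_nonneg_left h1 (by positivity)).trans hz)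
        rw [hu1, norm_sub_rev, pow_succ]
        linarith
    have hgeo : HasSum (fun m : ℕ ↦ ‖z‖ * (1 / 2 : ℝ) ^ m) (‖z‖ * 2) :=
      hasSum_geometric_two.mul_left _
    have hsum : Summable u := Summable.of_norm_bounded hgeo.summable hu
    refine ⟨∑' m, u m, ?_, ?_⟩
    · have h1 : HasSum (fun m ↦ f (u m)) (f (∑' m, u m)) := hsum.hasSum.map f hfc
      have h2 : HasSum (fun m ↦ u m - u (m + 1)) (∑' m, u m - (∑' m, u m - u 0)) := by
        refine hsum.hasSum.sub ?_
        simpa using (hasSum_nat_add_iff' 1).mpr hsum.hasSum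
      have h3 : (fun m ↦ u m - u (m + 1)) = fun m ↦ f (u m) := by
        ext m
        rw [hu1, sub_sub_cancel]
      rw [h3, sub_sub_cancel] at h2
      exact h1.unique h2
    · rw [mul_comm]
      exact hsum.hasSum.norm_le_of_bounded hgeo hu
  · have h1 := hg w hw
    rw [h0, zero_sub, norm_neg] at h1
    exact norm_le_zero_iff.mp (by linarith)

/-- The recursion formula for the coefficients of an exponential implies that they decrease
rapidly. -/
lemma exists_norm_le_of_recursion [NormOneClass B] {a e : ℕ → B} {D : ℕ → B} {n : ℕ}
    (ha : ∀ i, n < i → a i = 0) (he0 : e 0 = 1)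
    (he : ∀ i, e (i + 1) =
      D i * ∑ j : Fin (i + 1), a (j + 1) * e (i - j) ^ Fintype.card k ^ (j + 1 : ℕ))
    (hD : ∀ i, ‖D i‖ ≤ (1 / 2) ^ Fintype.card k ^ (i + 1)) :
    ∃ C ρ : ℝ, 1 ≤ C ∧ 0 ≤ ρ ∧ ρ < 1 ∧ ∀ i, ‖e i‖ ≤ (C * ρ ^ i) ^ Fintype.card k ^ i := by
  have hq : 2 ≤ Fintype.card k := Fintype.one_lt_card
  -- with `ρ ^ n ≥ 1 / 2`, the factor `(1 / 2) ^ (q ^ (i + 1))` from `D i` pays for the passage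
  -- from `ρ ^ (i - j)` to `ρ ^ (i + 1)` for each `j < n`
  obtain ⟨ρ, hρ0, hρ1, hρn⟩ : ∃ ρ : ℝ, 0 < ρ ∧ ρ < 1 ∧ 1 / 2 ≤ ρ ^ n := by
    have hn : (0 : ℝ) < n + 1 := by positivity
    have h1 : 1 / (2 * ((n : ℝ) + 1)) ≤ 1 / 2 := by
      apply one_div_le_one_div_of_le <;> linarith [n.cast_nonneg (α := ℝ)]
    have h0 : 0 < 1 / (2 * ((n : ℝ) + 1)) := by positivity
    refine ⟨1 + -(1 / (2 * (n + 1))), by linarith, by linarith, ?_⟩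
    refine le_trans ?_ (one_add_mul_le_pow (by linarith) n)
    have h2 : (n : ℝ) * (1 / (2 * (n + 1))) ≤ 1 / 2 := by
      rw [mul_one_div, div_le_iff₀ (by positivity)]
      linarith
    linarith
  let A : ℝ := 1 + ∑ j ∈ Finset.range n, ‖a (j + 1)‖
  have hA : 1 ≤ A := le_add_of_nonneg_right (Finset.sum_nonneg fun _ _ ↦ norm_nonneg _)
  have hsum (i : ℕ) : ∑ j : Fin (i + 1), ‖a (j + 1)‖ ≤ A := by
    rw [← Finset.sum_range fun j ↦ ‖a (j + 1)‖]
    have h1 : ∑ j ∈ Finset.range (i + 1), ‖a (j + 1)‖ ≤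
        ∑ j ∈ Finset.range (i + 1 + n), ‖a (j + 1)‖ :=
      Finset.sum_le_sum_of_subset_of_nonneg (Finset.range_mono (by omega))
        fun _ _ _ ↦ norm_nonneg _
    have h2 : ∑ j ∈ Finset.range n, ‖a (j + 1)‖ =
        ∑ j ∈ Finset.range (i + 1 + n), ‖a (j + 1)‖ := by
      refine Finset.sum_subset (Finset.range_mono (by omega)) fun j _ hj ↦ ?_
      rw [ha (j + 1) (by simpa [Nat.lt_succ_iff] using hj), norm_zero]
    linarith [h1, h2.ge, h2.le]
  -- the factor `A` on the left makes the induction work: the recursion is at least quadratic in `e`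
  have key (i : ℕ) : A * ‖e i‖ ≤ (A * ρ ^ i) ^ Fintype.card k ^ i := by
    induction i using Nat.strong_induction_on with
    | _ i ih =>
    cases i with
    | zero => simp [he0]
    | succ i =>
      let Q : ℕ := Fintype.card k ^ (i + 1)
      have hterm (j : Fin (i + 1)) :
          ‖a (j + 1) * e (i - j) ^ Fintype.card k ^ (j + 1 : ℕ)‖ ≤
            ‖a (j + 1)‖ * ((2 * (A * ρ ^ (i + 1))) ^ Q / A ^ 2) := by
        by_cases hj : n < j + 1
        · simp [ha _ hj]
        have hji : (j : ℕ) ≤ i := Nat.lt_succ_iff.mp j.2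
        let P : ℕ := Fintype.card k ^ (j + 1 : ℕ)
        have hP : 2 ≤ P := hq.trans (Nat.le_self_pow (by omega) _)
        refine (norm_mul_le _ _).trans (mul_le_mul_of_nonneg_left ?_ (norm_nonneg _))
        rw [le_div_iff₀ (by positivity)]
        calc ‖e (i - j) ^ P‖ * A ^ 2 ≤ ‖e (i - j)‖ ^ P * A ^ P := by
              refine mul_le_mul (norm_pow_le' _ (by omega)) (pow_le_pow_right₀ hA hP)
                (by positivity) (by positivity)
          _ = (A * ‖e (i - j)‖) ^ P := by rw [mul_pow, mul_comm]
          _ ≤ ((A * ρ ^ (i - j : ℕ)) ^ Fintype.card k ^ (i - j : ℕ)) ^ P :=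
              pow_le_pow_left₀ (by positivity) (ih _ (by omega)) _
          _ = (A * ρ ^ (i - j : ℕ)) ^ Q := by
              rw [← pow_mul, ← pow_add]
              congr 2
              omega
          _ ≤ (2 * (A * ρ ^ (i + 1))) ^ Q := by
              refine pow_le_pow_left₀ (by positivity) ?_ _
              have h1 : ρ ^ (i + 1) = ρ ^ (i - j : ℕ) * ρ ^ (j + 1 : ℕ) := by
                rw [← pow_add]
                congr 1
                omega
              have h2 : 1 / 2 ≤ ρ ^ (j + 1 : ℕ) :=
                hρn.trans (pow_le_pow_of_le_one hρ0.le hρ1.le (by omega))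
              have h3 : 0 < A * ρ ^ (i - j : ℕ) := by positivity
              rw [h1, ← mul_assoc A]
              nlinarith
      have h1 : ‖e (i + 1)‖ ≤ (1 / 2) ^ Q * (A * ((2 * (A * ρ ^ (i + 1))) ^ Q / A ^ 2)) := by
        rw [he]
        refine (norm_mul_le _ _).trans (mul_le_mul (hD i) ?_ (norm_nonneg _) (by positivity))
        refine (norm_sum_le _ _).trans ((Finset.sum_le_sum fun j _ ↦ hterm j).trans ?_)
        rw [← Finset.sum_mul]
        exact mul_le_mul_of_nonneg_right (hsum i) (by positivity)
      refine (mul_le_mul_of_nonneg_left h1 (by positivity)).trans_eq ?_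
      have hA0 : A ≠ 0 := by positivity
      rw [mul_pow 2, one_div, inv_pow]
      change _ = (A * ρ ^ (i + 1)) ^ Q
      field_simp
  exact ⟨A, ρ, hA, hρ0.le, hρ1, fun i ↦
    (le_mul_of_one_le_left (norm_nonneg _) hA).trans (key i)⟩

end FrobeniusSeries

/-! ### Growth of the coefficients of the exponential -/

section ExpBound

lemma algebraMap_poly_eq_polyToLocal {k K B : Type*} [Field k] [Field K] [Algebra k[X] K]
    [Algebra (RatFunc k) K] [IsScalarTower k[X] (RatFunc k) K] [CommRing B]
    [Algebra (LocalInfty k) B] [Algebra K B] [Algebra (RatFunc k) B] [IsScalarTower (RatFunc k) K B]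
    [IsScalarTower (RatFunc k) (LocalInfty k) B] (p : k[X]) :
    algebraMap K B (algebraMap k[X] K p) = algebraMap (LocalInfty k) B (polyToLocal k p) := by
  rw [IsScalarTower.algebraMap_apply k[X] (RatFunc k) K, ← IsScalarTower.algebraMap_apply,
    IsScalarTower.algebraMap_apply (RatFunc k) (LocalInfty k) B]
  rfl

variable {k R K B : Type*} [Field k] [CommRing R] [Algebra k[X] R]
  [Field K] [Algebra k[X] K] [Algebra (RatFunc k) K]
  [IsScalarTower k[X] (RatFunc k) K] [Algebra R K]
  [NormedCommRing B] [NormedAlgebra (LocalInfty k) B] [Algebra K B]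
  [Algebra (RatFunc k) B] [IsScalarTower (RatFunc k) K B]
  [IsScalarTower (RatFunc k) (LocalInfty k) B]

variable (B) in
/-- The denominator `t ^ (q ^ i) - t` in the recursion formula has absolute value `2 ^ (q ^ i)`. -/
lemma exists_norm_expCoeff_le [Fintype k] [NormOneClass B] (E : DrinfeldModel k R) :
    ∃ C ρ : ℝ, 1 ≤ C ∧ 0 ≤ ρ ∧ ρ < 1 ∧
      ∀ i, ‖algebraMap K B (E.expCoeff K i)‖ ≤ (C * ρ ^ i) ^ Fintype.card k ^ i := by
  refine exists_norm_le_of_recursion (k := k) (n := E.rank)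
    (a := fun i ↦ algebraMap K B (algebraMap R K (E.coeff i)))
    (D := fun i ↦ algebraMap K B ((algebraMap k[X] K X ^ Fintype.card k ^ (i + 1) -
      algebraMap k[X] K X)⁻¹)) (fun i hi ↦ ?_) ?_ (fun i ↦ ?_) fun i ↦ ?_
  · simp [E.coeff_eq_zero i hi]
  · simp [DrinfeldModel.expCoeff]
  · rw [DrinfeldModel.expCoeff, map_mul, map_sum]
    simp only [map_mul, map_pow]
  · have hp : natDegree (X ^ Fintype.card k ^ (i + 1) - X : k[X]) = Fintype.card k ^ (i + 1) :=
      FiniteField.X_pow_card_pow_sub_X_natDegree_eq k i.succ_ne_zero Fintype.one_lt_card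
    have hp0 : (X ^ Fintype.card k ^ (i + 1) - X : k[X]) ≠ 0 :=
      FiniteField.X_pow_card_pow_sub_X_ne_zero k i.succ_ne_zero Fintype.one_lt_card
    have hpl : polyToLocal k (X ^ Fintype.card k ^ (i + 1) - X) ≠ 0 := by
      rw [← norm_ne_zero_iff, norm_polyToLocal hp0]
      positivity
    -- the inverse may be computed in `k((1/t))`
    have h1 : algebraMap K B ((algebraMap k[X] K X ^ Fintype.card k ^ (i + 1) -
        algebraMap k[X] K X)⁻¹) =
        algebraMap (LocalInfty k) B (polyToLocal k (X ^ Fintype.card k ^ (i + 1) - X))⁻¹ := by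
      have h2 : algebraMap K B (algebraMap k[X] K (X ^ Fintype.card k ^ (i + 1) - X)) *
          algebraMap (LocalInfty k) B (polyToLocal k (X ^ Fintype.card k ^ (i + 1) - X))⁻¹ = 1 := by
        rw [algebraMap_poly_eq_polyToLocal, ← map_mul, mul_inv_cancel₀ hpl, map_one]
      have h3 : algebraMap k[X] K (X ^ Fintype.card k ^ (i + 1) - X) ≠ 0 := by
        rwa [Ne, map_eq_zero_iff _ (FunctionField.algebraMap_injective k K)]
      have h4 : algebraMap K B (algebraMap k[X] K (X ^ Fintype.card k ^ (i + 1) - X))⁻¹ *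
          algebraMap K B (algebraMap k[X] K (X ^ Fintype.card k ^ (i + 1) - X)) = 1 := by
        rw [← map_mul, inv_mul_cancel₀ h3, map_one]
      rw [← map_pow, ← map_sub]
      exact left_inv_eq_right_inv h4 h2
    rw [h1, norm_algebraMap', norm_inv, norm_polyToLocal hp0, hp, one_div, inv_pow]

end ExpBound

/-! ### The exponential on algebras of finite dimension over `k((1/t))` -/

section FiniteDimensional

variable {k R K A : Type*} [Field k] [Fintype k] [CommRing R] [Algebra k[X] R]
  [Field K] [Algebra k[X] K] [Algebra (RatFunc k) K]
  [IsScalarTower k[X] (RatFunc k) K] [Algebra R K]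

/-- The properties of a map `f : A → A` which make it an everywhere defined exponential of `E` that
is a local homeomorphism at `0`. -/
structure DrinfeldModel.IsExpOn (E : DrinfeldModel k R) (K : Type*) {A : Type*} [Field K]
    [Algebra k[X] K] [Algebra R K] [CommRing A] [Algebra K A] [TopologicalSpace A]
    (f : A →+ A) : Prop where
  continuous : Continuous f
  hasExp : ∀ x, E.HasExp K x (f x)
  image_mem_nhds : ∀ U ∈ nhds (0 : A), f '' U ∈ nhds (0 : A)
  exists_injOn : ∃ U ∈ nhds (0 : A), ∀ w ∈ U, f w = 0 → w = 0

lemma exists_isExpOn_of_normed {A : Type*} [NormedCommRing A] [NormOneClass A]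
    [NormedAlgebra (LocalInfty k) A] [Algebra K A]
    [Algebra (RatFunc k) A] [IsScalarTower (RatFunc k) K A]
    [IsScalarTower (RatFunc k) (LocalInfty k) A] [CompleteSpace A] (E : DrinfeldModel k R) :
    ∃ f : A →+ A, E.IsExpOn K f := by
  obtain ⟨C, ρ, hC, hρ0, hρ, he⟩ := exists_norm_expCoeff_le (K := K) A E
  obtain ⟨f, hfc, hf, hs, hi⟩ := exists_addMonoidHom_hasSum
    ((algebraMap K A).comp (DrinfeldModel.constMap k R K))
    (e := fun i ↦ algebraMap K A (E.expCoeff K i)) (by simp [DrinfeldModel.expCoeff]) hC hρ0 hρ he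
  have hsmall : ∀ᶠ z : A in nhds 0, 4 * C ^ 2 * ‖z‖ ≤ 1 := by
    have h2 : Filter.Tendsto (fun x : A ↦ 4 * C ^ 2 * ‖x‖) (nhds 0) (nhds 0) := by
      simpa using (tendsto_norm_zero (E := A)).const_mul (4 * C ^ 2)
    exact h2.eventually_le_const one_pos
  refine ⟨f, hfc, hf, fun U hU ↦ ?_, _, hsmall, fun w hw ↦ hi w hw⟩
  obtain ⟨ε, hε, hεU⟩ := Metric.mem_nhds_iff.mp hU
  filter_upwards [hsmall, Metric.ball_mem_nhds (0 : A) (half_pos hε)] with z hz hzε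
  obtain ⟨w, rfl, hw⟩ := hs z hz
  refine ⟨w, hεU ?_, rfl⟩
  rw [mem_ball_zero_iff] at hzε ⊢
  linarith

variable [CommRing A] [Algebra (LocalInfty k) A] [Algebra K A]
  [Algebra (RatFunc k) A] [IsScalarTower (RatFunc k) K A]
  [IsScalarTower (RatFunc k) (LocalInfty k) A] [FiniteDimensional (LocalInfty k) A]
  [TopologicalSpace A] [IsTopologicalRing A] [ContinuousSMul (LocalInfty k) A] [T2Space A]

/-- An injective homomorphism to a normed algebra induces a norm that defines the given topology,
since linear maps of finite dimensional spaces are continuous. -/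
lemma exists_isExpOn_of_injective {S : Type*} [NormedRing S] [NormOneClass S]
    [NormedAlgebra (LocalInfty k) S] (m : A →ₐ[LocalInfty k] S) (hm : Function.Injective m)
    (E : DrinfeldModel k R) : ∃ f : A →+ A, E.IsExpOn K f := by
  rename_i τ _ _ _
  have h : Topology.IsClosedEmbedding m :=
    LinearMap.isClosedEmbedding_of_injective (f := m.toLinearMap) (LinearMap.ker_eq_bot.mpr hm)
  obtain rfl := h.eq_induced
  let _ : NormedCommRing A := NormedCommRing.induced A S m hm
  let _ : NormedAlgebra (LocalInfty k) A := NormedAlgebra.induced (LocalInfty k) A S m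
  have : NormOneClass A := ⟨(congrArg norm (map_one m)).trans norm_one⟩
  have : CompleteSpace A := FiniteDimensional.complete (LocalInfty k) A
  exact exists_isExpOn_of_normed E

/-- The topology of a finite dimensional algebra is given by the operator norm of the
multiplication maps. -/
theorem exists_isExpOn [Nontrivial A] (E : DrinfeldModel k R) : ∃ f : A →+ A, E.IsExpOn K f := by
  have : Nonempty (Fin (Module.finrank (LocalInfty k) A)) :=
    Fin.pos_iff_nonempty.mp Module.finrank_pos
  let _ := Matrix.linftyOpNormedRing (n := Fin (Module.finrank (LocalInfty k) A))
    (α := LocalInfty k)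
  let _ := Matrix.linftyOpNormedAlgebra (n := Fin (Module.finrank (LocalInfty k) A))
    (R := LocalInfty k) (α := LocalInfty k)
  have := Matrix.linfty_opNormOneClass (n := Fin (Module.finrank (LocalInfty k) A))
    (α := LocalInfty k)
  exact exists_isExpOn_of_injective
    (Algebra.leftMulMatrix (Module.finBasis (LocalInfty k) A))
    (Algebra.leftMulMatrix_injective _) E

end FiniteDimensional

/-! ### Surjectivity of the exponential on separably closed fields -/

section SepClosed

/-- A separable polynomial with `P'(0) = 1` has a root of absolute value at most `|P(0)|`. -/
lemma exists_isRoot_norm_le {M : Type*} [NormedField M] [IsUltrametricDist M] {P : M[X]}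
    (hP : P.Splits) (hd : P.derivative.eval 0 = 1) : ∃ y, P.IsRoot y ∧ ‖y‖ ≤ ‖P.eval 0‖ := by
  by_cases h0 : P.eval 0 = 0
  · exact ⟨0, h0, by simp⟩
  have h1 := hP.eval_derivative_div_eval_of_ne_zero h0
  rw [hd] at h1
  have hne : P.roots ≠ 0 := by
    intro h
    rw [h, Multiset.map_zero, Multiset.sum_zero] at h1
    exact one_div_ne_zero h0 h1
  obtain ⟨z, hz, hle⟩ := IsUltrametricDist.exists_norm_multiset_sum_le P.roots
    (f := fun z ↦ 1 / (0 - z))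
  have hzr : P.IsRoot z := isRoot_of_mem_roots (hz hne)
  have hz0 : z ≠ 0 := fun h ↦ h0 (by rwa [h] at hzr)
  rw [← h1, zero_sub, norm_div, norm_div, norm_neg, norm_one] at hle
  exact ⟨z, hzr, (one_div_le_one_div (norm_pos_iff.mpr h0) (norm_pos_iff.mpr hz0)).mp hle⟩

/-- For an additive polynomial `f` with linear coefficient `1`, the equation `f(y) = x` has a
solution with `|y| ≤ |x|`. -/
lemma exists_sum_eq_norm_le {k M : Type*} [Field k] [Fintype k] [NormedField M]
    [IsUltrametricDist M] [IsSepClosed M] (φ : k →+* M) {e : ℕ → M} (he0 : e 0 = 1) (N : ℕ)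
    (x : M) : ∃ y, ∑ i ∈ Finset.range (N + 1), e i * y ^ Fintype.card k ^ i = x ∧ ‖y‖ ≤ ‖x‖ := by
  let P : M[X] := ∑ i ∈ Finset.range (N + 1), C (e i) * X ^ Fintype.card k ^ i - C x
  have hq : ((Fintype.card k : ℕ) : M) = 0 := by
    rw [← map_natCast φ, FiniteField.cast_card_eq_zero, map_zero]
  have hd : P.derivative = 1 := by
    simp only [P, derivative_sub, derivative_sum, derivative_C, sub_zero, derivative_C_mul_X_pow]
    rw [Finset.sum_range_succ', Finset.sum_eq_zero]
    · simp [he0]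
    · intro i _
      simp [hq, pow_succ]
  have hev (y : M) :
      P.eval y = ∑ i ∈ Finset.range (N + 1), e i * y ^ Fintype.card k ^ i - x := by
    simp [P, eval_finsetSum]
  have hsep : P.Separable := by
    rw [separable_def, hd]
    exact isCoprime_one_right
  obtain ⟨y, hy, hle⟩ := exists_isRoot_norm_le (IsSepClosed.splits_of_separable P hsep)
    (by rw [hd, eval_one])
  refine ⟨y, sub_eq_zero.mp ((hev y).symm.trans hy), ?_⟩
  have h0 : P.eval 0 = -x := by
    rw [hev, Finset.sum_eq_zero, zero_sub]
    intro i _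
    rw [DrinfeldModel.zero_pow_card, mul_zero]
  rwa [h0, norm_neg] at hle

section Adjoin

variable {k K A : Type*} [Field k] [Field K] [Algebra (RatFunc k) K]
  [FiniteDimensional (RatFunc k) K] [CommRing A] [Algebra (LocalInfty k) A]
  [Algebra.IsIntegral (LocalInfty k) A] [Algebra K A] [Algebra (RatFunc k) A]
  [IsScalarTower (RatFunc k) K A] [IsScalarTower (RatFunc k) (LocalInfty k) A]

variable (k K) in
/-- Finitely many elements of an integral algebra over `k((1/t))` lie in a subalgebra of finite
dimension which contains the image of `K`. -/
lemma exists_finiteDimensional_subalgebra (T : Finset A) :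
    ∃ S : Subalgebra (LocalInfty k) A, FiniteDimensional (LocalInfty k) S ∧ (∀ x ∈ T, x ∈ S) ∧
      ∀ a : K, algebraMap K A a ∈ S := by
  classical
  let b := Module.finBasis (RatFunc k) K
  let T' : Finset A := T ∪ Finset.univ.image fun i ↦ algebraMap K A (b i)
  have hT' (x : A) (hx : x ∈ T') : x ∈ Algebra.adjoin (LocalInfty k) (T' : Set A) :=
    Algebra.subset_adjoin hx
  refine ⟨Algebra.adjoin (LocalInfty k) (T' : Set A), ?_,
    fun x hx ↦ hT' x (Finset.mem_union_left _ hx), fun a ↦ ?_⟩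
  · exact Module.Finite.iff_fg.mpr (fg_adjoin_of_finite T'.finite_toSet
      fun x _ ↦ Algebra.IsIntegral.isIntegral x)
  · rw [← b.sum_repr a, map_sum]
    refine Subalgebra.sum_mem _ fun i _ ↦ ?_
    rw [Algebra.smul_def, map_mul, ← IsScalarTower.algebraMap_apply,
      IsScalarTower.algebraMap_apply (RatFunc k) (LocalInfty k) A]
    refine Subalgebra.mul_mem _ (Subalgebra.algebraMap_mem _ _) (hT' _ ?_)
    exact Finset.mem_union_right _ (Finset.mem_image_of_mem _ (Finset.mem_univ i))

end Adjoin

variable {k R K M : Type*} [Field k] [Fintype k] [CommRing R] [Algebra k[X] R]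
  [Field K] [Algebra k[X] K] [Algebra (RatFunc k) K] [FiniteDimensional (RatFunc k) K]
  [IsScalarTower k[X] (RatFunc k) K] [Algebra R K]
  [NormedField M] [IsUltrametricDist M] [NormedAlgebra (LocalInfty k) M]
  [Algebra.IsAlgebraic (LocalInfty k) M] [IsSepClosed M] [Algebra K M] [Algebra (RatFunc k) M]
  [IsScalarTower (RatFunc k) K M] [IsScalarTower (RatFunc k) (LocalInfty k) M]

/-- A long truncation of the equation `exp_E(y) = x` has a solution with `|y| ≤ |x|`. The error is
so small that it can be corrected in the complete subfield that is generated by `x`, `y` and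
`K`. -/
theorem exists_hasExp_eq_of_isSepClosed (E : DrinfeldModel k R) (x : M) :
    ∃ y, E.HasExp K y x := by
  have hq : 2 ≤ Fintype.card k := Fintype.one_lt_card
  obtain ⟨C, ρ, hC, hρ0, hρ, he⟩ := exists_norm_expCoeff_le (K := K) M E
  let e : ℕ → M := fun i ↦ algebraMap K M (E.expCoeff K i)
  have he0 : e 0 = 1 := by simp [e, DrinfeldModel.expCoeff]
  let g : ℕ → ℝ := fun i ↦ (C * ρ ^ i * ‖x‖) ^ Fintype.card k ^ i
  have hg : Summable g :=
    summable_mul_pow_pow hq (zero_le_one.trans hC) hρ0 hρ (norm_nonneg x)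
  obtain ⟨N, hN⟩ : ∃ N : ℕ, 4 * C ^ 2 * ∑' i, g (i + (N + 1)) ≤ 1 := by
    have h1 : Filter.Tendsto (fun N ↦ 4 * C ^ 2 * ∑' i, g (i + (N + 1))) Filter.atTop
        (nhds 0) := by
      have := ((tendsto_sum_nat_add g).comp (Filter.tendsto_add_atTop_nat 1)).const_mul (4 * C ^ 2)
      simpa using this
    exact (h1.eventually_le_const one_pos).exists
  obtain ⟨y, hy, hyx⟩ := exists_sum_eq_norm_le
    ((algebraMap K M).comp (DrinfeldModel.constMap k R K)) he0 N x
  classical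
  obtain ⟨S, hS, hTS, hKS⟩ := exists_finiteDimensional_subalgebra k K ({x, y} : Finset M)
  have : CompleteSpace S := FiniteDimensional.complete (LocalInfty k) S
  let x' : S := ⟨x, hTS x (by simp)⟩
  let y' : S := ⟨y, hTS y (by simp)⟩
  let e' : ℕ → S := fun i ↦ ⟨e i, hKS _⟩
  obtain ⟨f, -, hf, hs, -⟩ := exists_addMonoidHom_hasSum (B := S)
    (((algebraMap K M).comp (DrinfeldModel.constMap k R K)).codRestrict S fun c ↦ hKS _)
    (e := e') (Subtype.ext he0) hC hρ0 hρ he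
  have h1 : HasSum (fun i ↦ e' (i + (N + 1)) * y' ^ Fintype.card k ^ (i + (N + 1)))
      (f y' - x') := by
    have h2 := (hasSum_nat_add_iff' (N + 1)).mpr (hf y')
    have h3 : ∑ i ∈ Finset.range (N + 1), e' i * y' ^ Fintype.card k ^ i = x' := by
      refine Subtype.ext ?_
      simpa [e', x', y'] using hy
    rwa [h3] at h2
  have h2 : ‖f y' - x'‖ ≤ ∑' i, g (i + (N + 1)) := by
    refine h1.norm_le_of_bounded ((summable_nat_add_iff (N + 1)).mpr hg).hasSum fun i ↦ ?_
    refine (norm_mul_pow_card_le (e := e') he y' _).trans ?_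
    refine pow_le_pow_left₀ (by positivity) ?_ _
    exact mul_le_mul_of_nonneg_left hyx (by positivity)
  obtain ⟨w, hw, -⟩ := hs (f y' - x') ((mul_le_mul_of_nonneg_left h2 (by positivity)).trans hN)
  have h3 : f (y' - w) = x' := by rw [map_sub, hw, sub_sub_cancel]
  have h4 := (hf (y' - w)).map S.val continuous_subtype_val
  rw [h3] at h4
  exact ⟨(y' - w : S), h4⟩

end SepClosed

/-! ### Surjectivity of the exponential on finite algebras over separably closed fields -/

section Surjective

variable {k R K A : Type*} [Field k] [Fintype k] [CommRing R] [Algebra k[X] R]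
  [Field K] [Algebra k[X] K] [Algebra R K] [CommRing A] [Algebra K A]
  [TopologicalSpace A] [IsTopologicalRing A]

/-- The variant of `DrinfeldModel.HasExp.add` for `K`-algebras without a given structure of
`k[t]`-algebra. -/
lemma hasExp_add {E : DrinfeldModel k R} {x x' y y' : A} (h : E.HasExp K x y)
    (h' : E.HasExp K x' y') : E.HasExp K (x + x') (y + y') := by
  unfold DrinfeldModel.HasExp at *
  simpa only [DrinfeldModel.add_pow_card ((algebraMap K A).comp (DrinfeldModel.constMap k R K)),
    mul_add] using HasSum.add h h'

/-- On nilpotent elements the exponential is a finite sum. It differs from the identity by terms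
that are divisible by the square, which allows to invert it step by step. -/
lemma exists_hasExp_eq_of_pow_eq_zero (E : DrinfeldModel k R) (s : ℕ) (n : A)
    (hn : n ^ 2 ^ s = 0) : ∃ w, E.HasExp K w n := by
  induction s generalizing n with
  | zero =>
    rw [pow_zero, pow_one] at hn
    subst hn
    exact ⟨0, by simp [DrinfeldModel.HasExp]⟩
  | succ s ih =>
    let u : ℕ → A := fun i ↦ algebraMap K A (E.expCoeff K i) * n ^ Fintype.card k ^ i
    have hq : 2 ≤ Fintype.card k := Fintype.one_lt_card
    have h1 : E.HasExp K n (∑ i ∈ Finset.range (s + 1), u i) := by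
      refine hasSum_sum_of_ne_finset_zero fun i hi ↦ ?_
      have h2 : 2 ^ (s + 1) ≤ Fintype.card k ^ i :=
        (pow_le_pow_right₀ one_le_two (by simpa using hi)).trans (Nat.pow_le_pow_left hq i)
      rw [pow_eq_zero_of_le h2 hn, mul_zero]
    obtain ⟨h, hh⟩ : n ^ 2 ∣ ∑ i ∈ Finset.range s, u (i + 1) := by
      refine Finset.dvd_sum fun i _ ↦ Dvd.dvd.mul_left (pow_dvd_pow n ?_) _
      exact hq.trans (Nat.le_self_pow i.succ_ne_zero _)
    have hu0 : u 0 = n := by simp [u, DrinfeldModel.expCoeff]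
    rw [Finset.sum_range_succ', hu0, hh] at h1
    obtain ⟨w, hw⟩ := ih (-(n ^ 2 * h)) (by
      rw [neg_pow, mul_pow, ← pow_mul, ← pow_succ', hn, zero_mul, mul_zero])
    refine ⟨n + w, ?_⟩
    have h2 := hasExp_add h1 hw
    rwa [add_right_comm, add_neg_cancel, zero_add] at h2

variable [Algebra (RatFunc k) K] [FiniteDimensional (RatFunc k) K]
  [IsScalarTower k[X] (RatFunc k) K] [Algebra (LocalInfty k) A]
  [Algebra.IsIntegral (LocalInfty k) A]
  [Algebra (RatFunc k) A] [IsScalarTower (RatFunc k) K A]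
  [IsScalarTower (RatFunc k) (LocalInfty k) A] [ContinuousSMul (LocalInfty k) A] [T2Space A]

variable (K) in
/-- The exponential converges at each `y`, already in a subalgebra of finite dimension. -/
lemma exists_hasSum_finiteDimensional_subalgebra [Nontrivial A] (E : DrinfeldModel k R) (y : A) :
    ∃ (S : Subalgebra (LocalInfty k) A) (u : ℕ → S) (z : S), FiniteDimensional (LocalInfty k) S ∧
      HasSum u z ∧ ∀ i, (u i : A) = algebraMap K A (E.expCoeff K i) * y ^ Fintype.card k ^ i := by
  obtain ⟨S, hS, hyS, hKS⟩ := exists_finiteDimensional_subalgebra k K ({y} : Finset A)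
  have : IsTopologicalRing S := inferInstanceAs (IsTopologicalRing S.toSubring)
  let _ : Algebra K S := ((algebraMap K A).codRestrict S hKS).toAlgebra
  have : IsScalarTower (RatFunc k) K S := IsScalarTower.of_algebraMap_eq fun r ↦ Subtype.ext
    (IsScalarTower.algebraMap_apply (RatFunc k) K A r)
  obtain ⟨f, hf⟩ := exists_isExpOn (K := K) (A := S) E
  exact ⟨S, _, _, hS, hf.hasExp ⟨y, hyS y (by simp)⟩, fun i ↦ rfl⟩

variable (K) in
lemma exists_hasExp [Nontrivial A] (E : DrinfeldModel k R) (y : A) : ∃ z, E.HasExp K y z := by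
  obtain ⟨S, u, z, -, h, hu⟩ := exists_hasSum_finiteDimensional_subalgebra K E y
  have h1 := h.map S.val continuous_subtype_val
  exact ⟨z, h1.congr_fun fun i ↦ (hu i).symm⟩

/-- A point of a separably closed quotient field has a logarithm there; along the quotient map, the
exponential of a lift is a lift of the given point. -/
lemma exists_map_eq_of_hasExp [Nontrivial A] {M : Type*} [Field M] [Algebra (LocalInfty k) M]
    [Algebra.IsAlgebraic (LocalInfty k) M] [IsSepClosed M] (π : A →ₐ[LocalInfty k] M)
    (E : DrinfeldModel k R) (x : A) :
    ∃ b : M, ∀ y z, π y = b → E.HasExp K y z → π z = π x := by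
  let _ := spectralNorm.normedField (LocalInfty k) M
  let _ := spectralNorm.normedAlgebra (LocalInfty k) M
  have : IsUltrametricDist M := IsUltrametricDist.isUltrametricDist_of_isNonarchimedean_norm
    isNonarchimedean_spectralNorm
  let _ : Algebra K M := ((π : A →+* M).comp (algebraMap K A)).toAlgebra
  let _ : Algebra (RatFunc k) M :=
    ((algebraMap (LocalInfty k) M).comp (algebraMap (RatFunc k) (LocalInfty k))).toAlgebra
  have : IsScalarTower (RatFunc k) (LocalInfty k) M := IsScalarTower.of_algebraMap_eq' rfl
  have : IsScalarTower (RatFunc k) K M := IsScalarTower.of_algebraMap_eq fun r ↦ by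
    change algebraMap (LocalInfty k) M (algebraMap (RatFunc k) (LocalInfty k) r) =
      π (algebraMap K A (algebraMap (RatFunc k) K r))
    rw [← IsScalarTower.algebraMap_apply (RatFunc k) K A,
      IsScalarTower.algebraMap_apply (RatFunc k) (LocalInfty k) A, AlgHom.commutes]
  obtain ⟨b, hb⟩ := exists_hasExp_eq_of_isSepClosed (K := K) E (π x)
  refine ⟨b, fun y z hy hyz ↦ ?_⟩
  obtain ⟨S, u, z', hS, h, hu⟩ := exists_hasSum_finiteDimensional_subalgebra K E y
  have hz : z = z' := by
    have h1 := h.map S.val continuous_subtype_val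
    exact hyz.unique (h1.congr_fun fun i ↦ (hu i).symm)
  have : IsTopologicalRing S := inferInstanceAs (IsTopologicalRing S.toSubring)
  have h2 : Continuous (π.comp S.val) :=
    LinearMap.continuous_of_finiteDimensional (π.comp S.val).toLinearMap
  have h3 := h.map (π.comp S.val) h2
  rw [hz]
  refine HasSum.unique (h3.congr_fun fun i ↦ ?_) hb
  change _ = π (u i)
  rw [hu, map_mul, map_pow, hy]
  rfl

/-- Surjectivity of the exponential on a finite algebra `A` over a separably closed field. Solutions
in the quotient fields are combined with the Chinese remainder theorem; the error is
nilpotent. -/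
theorem exists_hasExp_eq [Nontrivial A] {L : Type*} [Field L] [IsSepClosed L] [Algebra L A]
    [Module.Finite L A] (E : DrinfeldModel k R) (x : A) : ∃ y, E.HasExp K y x := by
  have : IsArtinianRing A := IsArtinianRing.of_finite L A
  have hex (m : MaximalSpectrum A) : ∃ a : A, ∀ y z, y - a ∈ m.asIdeal → E.HasExp K y z →
      z - x ∈ m.asIdeal := by
    have := m.isMaximal
    let _ := Ideal.Quotient.field m.asIdeal
    have : Algebra.IsAlgebraic L (A ⧸ m.asIdeal) := Algebra.IsAlgebraic.of_finite _ _
    have : IsSepClosed (A ⧸ m.asIdeal) := Algebra.IsAlgebraic.isSepClosed (F := L)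
    have : Algebra.IsIntegral (LocalInfty k) (A ⧸ m.asIdeal) :=
      Algebra.IsIntegral.of_surjective (Ideal.Quotient.mkₐ (LocalInfty k) m.asIdeal)
        Ideal.Quotient.mk_surjective
    have : Algebra.IsAlgebraic (LocalInfty k) (A ⧸ m.asIdeal) := Algebra.IsIntegral.isAlgebraic
    obtain ⟨b, hb⟩ := exists_map_eq_of_hasExp (K := K)
      (Ideal.Quotient.mkₐ (LocalInfty k) m.asIdeal) E x
    obtain ⟨a, rfl⟩ := Ideal.Quotient.mk_surjective b
    exact ⟨a, fun y z hy hyz ↦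
      Ideal.Quotient.eq.mp (hb y z (Ideal.Quotient.eq.mpr hy) hyz)⟩
  choose a ha using hex
  obtain ⟨y, hy⟩ := Ideal.exists_forall_sub_mem_ideal
    (I := fun m : MaximalSpectrum A ↦ m.asIdeal)
    (fun m m' h ↦ Ideal.isCoprime_of_isMaximal fun h' ↦ h (MaximalSpectrum.ext h')) a
  obtain ⟨z, hz⟩ := exists_hasExp K E y
  have hnil : IsNilpotent (x - z) := by
    rw [nilpotent_iff_mem_prime]
    intro J hJ
    have hmax : J.IsMaximal := hJ.isMaximal'
    have := ha ⟨J, hmax⟩ y z (hy _) hz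
    rw [← neg_sub]
    exact J.neg_mem this
  obtain ⟨s, hs⟩ := hnil
  obtain ⟨w, hw⟩ := exists_hasExp_eq_of_pow_eq_zero (K := K) E s (x - z)
    (pow_eq_zero_of_le Nat.lt_two_pow_self.le hs)
  refine ⟨y + w, ?_⟩
  have h2 := hasExp_add hz hw
  rwa [add_sub_cancel] at h2

end Surjective

/-! ### The algebras `K ⊗ L` over `k((1/t))` -/

section TensorFacts

variable (k K L : Type*) [Field k] [Field K] [Field L] [Algebra (RatFunc k) K]
  [Algebra (LocalInfty k) L] [Algebra (RatFunc k) L]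
  [IsScalarTower (RatFunc k) (LocalInfty k) L]

/-- The structure of an algebra over `k((1/t))` on `K ⊗ L` which comes from the second factor. -/
instance tensorLocalAlgebra : Algebra (LocalInfty k) (K ⊗[RatFunc k] L) :=
  ((Algebra.TensorProduct.includeRight : L →ₐ[RatFunc k] K ⊗[RatFunc k] L).toRingHom.comp
    (algebraMap (LocalInfty k) L)).toAlgebra

variable {k K L}

omit [IsScalarTower (RatFunc k) (LocalInfty k) L] in
lemma algebraMap_tensor_apply (c : LocalInfty k) :
    algebraMap (LocalInfty k) (K ⊗[RatFunc k] L) c = 1 ⊗ₜ algebraMap (LocalInfty k) L c := rfl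

instance : IsScalarTower (RatFunc k) (LocalInfty k) (K ⊗[RatFunc k] L) :=
  IsScalarTower.of_algebraMap_eq fun r ↦ by
    rw [algebraMap_tensor_apply, ← IsScalarTower.algebraMap_apply,
      ← Algebra.TensorProduct.tmul_one_eq_one_tmul]
    rfl

variable (k L) in
/-- The inclusion `L → K ⊗ L` over `k((1/t))`. -/
def tensorIncludeRight (K : Type*) [Field K] [Algebra (RatFunc k) K] :
    L →ₐ[LocalInfty k] K ⊗[RatFunc k] L :=
  { (Algebra.TensorProduct.includeRight : L →ₐ[RatFunc k] K ⊗[RatFunc k] L) with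
    commutes' := fun _ ↦ rfl }

instance [FiniteDimensional (RatFunc k) K] [Algebra.IsAlgebraic (LocalInfty k) L] :
    Algebra.IsIntegral (LocalInfty k) (K ⊗[RatFunc k] L) where
  isIntegral z := by
    induction z with
    | zero => exact isIntegral_zero
    | add x y hx hy => exact hx.add hy
    | tmul x y =>
      have h1 : IsIntegral (LocalInfty k) (x ⊗ₜ 1 : K ⊗[RatFunc k] L) := by
        have h2 : IsIntegral (RatFunc k) x := Algebra.IsIntegral.isIntegral x
        exact (h2.map (Algebra.TensorProduct.includeLeft :
          K →ₐ[RatFunc k] K ⊗[RatFunc k] L)).tower_top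
      have h3 : IsIntegral (LocalInfty k) (1 ⊗ₜ y : K ⊗[RatFunc k] L) := by
        have h2 : IsIntegral (LocalInfty k) y := (Algebra.IsAlgebraic.isAlgebraic y).isIntegral
        exact h2.map (tensorIncludeRight k L K)
      have h4 := h1.mul h3
      rwa [Algebra.TensorProduct.tmul_mul_tmul, mul_one, one_mul] at h4

instance [FiniteDimensional (RatFunc k) K] :
    FiniteDimensional (LocalInfty k) (K ⊗[RatFunc k] LocalInfty k) := by
  let _ : Algebra (LocalInfty k) (K ⊗[RatFunc k] LocalInfty k) :=
    Algebra.TensorProduct.rightAlgebra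
  exact Module.Finite.equiv
    (Algebra.TensorProduct.commRight (RatFunc k) (LocalInfty k) K).toLinearEquiv

variable [Algebra.IsAlgebraic (LocalInfty k) L]

instance [FiniteDimensional (RatFunc k) K] :
    ContinuousSMul (LocalInfty k) (K ⊗[RatFunc k] L) := by
  let _ := spectralNorm.normedField (LocalInfty k) L
  let _ := spectralNorm.normedAlgebra (LocalInfty k) L
  let _ : Algebra L (K ⊗[RatFunc k] L) := Algebra.TensorProduct.rightAlgebra
  have : IsModuleTopology L (K ⊗[RatFunc k] L) := ⟨rfl⟩
  have h : Continuous fun p : LocalInfty k × (K ⊗[RatFunc k] L) ↦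
      algebraMap (LocalInfty k) L p.1 • p.2 :=
    ((continuous_algebraMap (LocalInfty k) L).comp continuous_fst).smul continuous_snd
  exact ⟨h⟩

instance [FiniteDimensional (RatFunc k) K] : T2Space (K ⊗[RatFunc k] L) := by
  let _ := spectralNorm.normedField (LocalInfty k) L
  let _ : Algebra L (K ⊗[RatFunc k] L) := Algebra.TensorProduct.rightAlgebra
  have : IsModuleTopology L (K ⊗[RatFunc k] L) := ⟨rfl⟩
  have : Module.Finite L (K ⊗[RatFunc k] L) :=
    Module.Finite.equiv (Algebra.TensorProduct.commRight (RatFunc k) L K).toLinearEquiv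
  let e := (Module.finBasis L (K ⊗[RatFunc k] L)).equivFun
  exact T2Space.of_injective_continuous e.injective
    (IsModuleTopology.continuous_of_linearMap e.toLinearMap)

/-- The inclusion `K_∞ → K ⊗ L` over `k((1/t))`. -/
def fromLocalₐ (K L : Type*) [Field K] [Field L] [Algebra (RatFunc k) K]
    [Algebra (LocalInfty k) L] [Algebra (RatFunc k) L]
    [IsScalarTower (RatFunc k) (LocalInfty k) L] :
    K ⊗[RatFunc k] LocalInfty k →ₐ[LocalInfty k] K ⊗[RatFunc k] L :=
  { fromLocal K L with
    commutes' := fun c ↦ by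
      change fromLocal K L (1 ⊗ₜ c) = 1 ⊗ₜ _
      simp [fromLocal] }

lemma continuous_fromLocal [FiniteDimensional (RatFunc k) K] :
    Continuous (fromLocal (k := k) K L) :=
  LinearMap.continuous_of_finiteDimensional (fromLocalₐ K L).toLinearMap

omit [Algebra.IsAlgebraic (LocalInfty k) L] in
lemma fromLocal_injective : Function.Injective (fromLocal (k := k) K L) := by
  have h := Module.Flat.lTensor_preserves_injective_linearMap (M := K)
    (IsScalarTower.toAlgHom (RatFunc k) (LocalInfty k) L).toLinearMap
    (algebraMap (LocalInfty k) L).injective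
  exact h

omit [Algebra.IsAlgebraic (LocalInfty k) L] in
/-- The coordinates with respect to a basis of `K` reduce Galois descent to the case of fields. -/
lemma exists_fromLocal_eq_of_galAct_eq [IsGalois (LocalInfty k) L] (z : K ⊗[RatFunc k] L)
    (hz : ∀ σ : Gal(L/LocalInfty k), galAct K σ z = z) : ∃ x, fromLocal K L x = z := by
  classical
  let b := Module.Basis.ofVectorSpace (RatFunc k) K
  let e := TensorProduct.equivFinsuppOfBasisLeft (N := L) b
  have he (σ : Gal(L/LocalInfty k)) (z : K ⊗[RatFunc k] L) (i) :
      e (galAct K σ z) i = σ (e z i) := by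
    induction z with
    | zero => simp
    | add x y hx hy => simp only [map_add, Finsupp.add_apply, hx, hy]
    | tmul x y => simp [e, Algebra.smul_def,
        IsScalarTower.algebraMap_apply (RatFunc k) (LocalInfty k) L]
  have hc (i) : ∃ c : LocalInfty k, algebraMap (LocalInfty k) L c = e z i := by
    refine (InfiniteGalois.mem_range_algebraMap_iff_fixed (k := LocalInfty k) (e z i)).mpr
      fun σ ↦ ?_
    rw [← he, hz]
  choose c hc using hc
  refine ⟨∑ i ∈ (e z).support, b i ⊗ₜ c i, ?_⟩
  rw [map_sum]
  conv_rhs => rw [← e.symm_apply_apply z, TensorProduct.equivFinsuppOfBasisLeft_symm_apply]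
  refine Finset.sum_congr rfl fun i _ ↦ ?_
  change b i ⊗ₜ algebraMap (LocalInfty k) L (c i) = _
  rw [hc]

/-- The stabiliser of an element of `K ⊗ L` is open. -/
lemma eventually_galAct_eq (y : K ⊗[RatFunc k] L) :
    ∀ᶠ σ : Gal(L/LocalInfty k) in nhds 1, galAct K σ y = y := by
  induction y with
  | zero => simp
  | add x y hx hy =>
    filter_upwards [hx, hy] with σ h1 h2
    rw [map_add, h1, h2]
  | tmul x y =>
    have h : IsIntegral (LocalInfty k) y := (Algebra.IsAlgebraic.isAlgebraic y).isIntegral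
    have := IntermediateField.adjoin.finiteDimensional h
    have hopen := IntermediateField.fixingSubgroup_isOpen
      (IntermediateField.adjoin (LocalInfty k) {y})
    filter_upwards [hopen.mem_nhds (one_mem _)] with σ hσ
    rw [galAct_tmul]
    congr 1
    exact hσ ⟨y, IntermediateField.mem_adjoin_simple_self _ y⟩

lemma continuous_galAct_sub (y : K ⊗[RatFunc k] L) [FiniteDimensional (RatFunc k) K] :
    Continuous fun σ : Gal(L/LocalInfty k) ↦ galAct K σ y - y := by
  refine continuous_iff_continuousAt.mpr fun σ ↦ ?_
  refine tendsto_nhds_of_eventually_eq ?_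
  have h1 : Filter.Tendsto (fun τ : Gal(L/LocalInfty k) ↦ σ⁻¹ * τ) (nhds σ) (nhds 1) := by
    have h2 : ContinuousAt (fun τ : Gal(L/LocalInfty k) ↦ σ⁻¹ * τ) σ :=
      (continuous_const_mul σ⁻¹).continuousAt
    rwa [ContinuousAt, inv_mul_cancel] at h2
  filter_upwards [h1.eventually (eventually_galAct_eq y)] with τ hτ
  have h2 := congrArg (galAct K σ) hτ
  rw [← galAct_mul, mul_inv_cancel_left] at h2
  rw [h2]

end TensorFacts

/-! ### The integral closure of `k[t]` in `K` -/

section IntegralClosureFinite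

lemma finite_of_injective_semilinear {S T M N : Type*} [CommRing S] [IsNoetherianRing S]
    [CommRing T] {σ : S →+* T} (hσ : σ.Finite) [AddCommGroup M] [Module S M] [AddCommGroup N]
    [Module T N] [Module.Finite T N] (ψ : M →ₛₗ[σ] N) (hψ : Function.Injective ψ) :
    Module.Finite S M := by
  let _ : Algebra S T := σ.toAlgebra
  have : Module.Finite S T := hσ
  let _ : Module S N := Module.compHom N σ
  have : IsScalarTower S T N := IsScalarTower.of_algebraMap_smul fun _ _ ↦ rfl
  have : Module.Finite S N := Module.Finite.trans T N
  let ψ' : M →ₗ[S] N := { ψ with map_smul' := fun s m ↦ ψ.map_smulₛₗ s m }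
  have : IsNoetherian S M := isNoetherian_of_injective ψ' hψ
  infer_instance

/-- A power of the Frobenius of `k[t]` is finite, as `k` is perfect. -/
lemma finite_iterateFrobenius_polynomial (k : Type*) [Field k] [Finite k] (p : ℕ) [ExpChar k p]
    (n : ℕ) : (iterateFrobenius k[X] p n).Finite := by
  refine RingHom.IsIntegral.to_finite (fun g ↦ ?_) ?_
  · refine ⟨X ^ p ^ n - C g, monic_X_pow_sub_C _ (expChar_pow_pos k p n).ne', ?_⟩
    simp [iterateFrobenius_def]
  · have h : (iterateFrobenius k[X] p n).comp C = (C : k →+* k[X]).comp (iterateFrobenius k p n) :=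
      RingHom.ext fun c ↦ by simp [iterateFrobenius_def]
    refine RingHom.FiniteType.of_comp_finiteType (f := C) ?_
    rw [h]
    refine RingHom.FiniteType.comp ?_
      (RingHom.FiniteType.of_surjective _ (bijective_iterateFrobenius k p n).2)
    rw [← algebraMap_eq, RingHom.finiteType_algebraMap]
    infer_instance

/-- The integral closure of `k[t]` in a finite extension of `k(t)` is a finite module, even if the
extension is inseparable: a power of the Frobenius maps it into the integral closure in a separable
extension. -/
theorem finite_integralClosure (k K R : Type*) [Field k] [Finite k] [Field K] [Algebra k[X] K]
    [Algebra (RatFunc k) K] [IsScalarTower k[X] (RatFunc k) K] [FiniteDimensional (RatFunc k) K]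
    [CommRing R] [Algebra k[X] R] [Algebra R K] [IsScalarTower k[X] R K]
    [IsIntegralClosure R k[X] K] : Module.Finite k[X] R := by
  let Ks := separableClosure (RatFunc k) K
  let p := ringExpChar k
  have : ExpChar k[X] p := expChar_of_injective_ringHom (C_injective (R := k)) p
  have : ExpChar (RatFunc k) p :=
    expChar_of_injective_ringHom (IsFractionRing.injective k[X] (RatFunc k)) p
  have : ExpChar Ks p := expChar_of_injective_ringHom (algebraMap (RatFunc k) Ks).injective p
  have : IsScalarTower k[X] Ks K := IsScalarTower.of_algebraMap_eq fun g ↦ by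
    rw [IsScalarTower.algebraMap_apply k[X] (RatFunc k) K,
      IsScalarTower.algebraMap_apply k[X] (RatFunc k) Ks]
    rfl
  have hfin : Module.Finite k[X] (integralClosure k[X] Ks) :=
    IsIntegralClosure.finite k[X] (RatFunc k) Ks _
  let n := IsPurelyInseparable.exponent Ks K
  let Φ : K →+* Ks := IsPurelyInseparable.iterateFrobenius Ks K p (n := n) le_rfl
  have hΦ (a : K) : algebraMap Ks K (Φ a) = a ^ p ^ n :=
    IsPurelyInseparable.algebraMap_iterateFrobenius Ks p le_rfl a
  have hint (r : R) : IsIntegral k[X] (Φ (algebraMap R K r)) := by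
    refine (isIntegral_algebraMap_iff (algebraMap Ks K).injective).mp ?_
    rw [hΦ]
    exact ((IsIntegralClosure.isIntegral k[X] K r).algebraMap (B := K)).pow _
  let ψ : R →ₛₗ[iterateFrobenius k[X] p n] integralClosure k[X] Ks :=
    { toFun r := ⟨Φ (algebraMap R K r), hint r⟩
      map_add' r s := Subtype.ext (by simp)
      map_smul' g r := Subtype.ext <| (algebraMap Ks K).injective <| by
        change algebraMap Ks K (Φ (algebraMap R K (g • r))) =
          algebraMap Ks K (iterateFrobenius k[X] p n g • Φ (algebraMap R K r))
        rw [hΦ, Algebra.smul_def, Algebra.smul_def, map_mul, map_mul, mul_pow, hΦ,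
          ← IsScalarTower.algebraMap_apply, ← IsScalarTower.algebraMap_apply, iterateFrobenius_def,
          map_pow] }
  refine finite_of_injective_semilinear (finite_iterateFrobenius_polynomial k p n) ψ fun r s h ↦ ?_
  have h1 : Φ (algebraMap R K r) = Φ (algebraMap R K s) := congrArg Subtype.val h
  exact IsIntegralClosure.algebraMap_injective R k[X] K (Φ.injective h1)

variable {k K R : Type*} [Field k] [Finite k] [Field K] [Algebra k[X] K] [Algebra (RatFunc k) K]
  [IsScalarTower k[X] (RatFunc k) K] [FiniteDimensional (RatFunc k) K] [CommRing R]
  [Algebra k[X] R] [Algebra R K] [IsScalarTower k[X] R K] [IsIntegralClosure R k[X] K]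

/-- The coordinates of integral elements have a common denominator. -/
lemma exists_common_denominator {ι : Type*} [Finite ι] (b : Module.Basis ι (RatFunc k) K) :
    ∃ d : k[X], d ≠ 0 ∧ ∀ (r : R) i, ∃ g : k[X],
      algebraMap k[X] (RatFunc k) d * b.repr (algebraMap R K r) i =
        algebraMap k[X] (RatFunc k) g := by
  classical
  have := Fintype.ofFinite ι
  obtain ⟨G, hG⟩ := (finite_integralClosure k K R).fg_top
  obtain ⟨d, hd⟩ := IsLocalization.exist_integer_multiples_of_finset (nonZeroDivisors k[X])
    ((G ×ˢ (Finset.univ : Finset ι)).image fun x ↦ b.repr (algebraMap R K x.1) x.2)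
  refine ⟨d, nonZeroDivisors.coe_ne_zero d, fun r i ↦ ?_⟩
  have hr : r ∈ Submodule.span k[X] (G : Set R) := hG ▸ Submodule.mem_top
  induction hr using Submodule.span_induction with
  | mem x hx =>
    obtain ⟨g, hg⟩ := hd _ (Finset.mem_image.mpr
      ⟨(x, i), Finset.mem_product.mpr ⟨hx, Finset.mem_univ i⟩, rfl⟩)
    exact ⟨g, by rw [hg, Algebra.smul_def]⟩
  | zero => exact ⟨0, by simp⟩
  | add x y _ _ hx hy =>
    obtain ⟨g, hg⟩ := hx
    obtain ⟨h, hh⟩ := hy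
    exact ⟨g + h, by rw [map_add, map_add, Finsupp.add_apply, mul_add, hg, hh, map_add]⟩
  | smul a x _ hx =>
    obtain ⟨g, hg⟩ := hx
    refine ⟨a * g, ?_⟩
    have h : algebraMap R K (a • x) = algebraMap k[X] (RatFunc k) a • algebraMap R K x := by
      rw [Algebra.smul_def, map_mul, ← IsScalarTower.algebraMap_apply,
        IsScalarTower.algebraMap_apply k[X] (RatFunc k) K, ← Algebra.smul_def]
    rw [h, map_smul, Finsupp.smul_apply, smul_eq_mul, mul_left_comm, hg, map_mul]

end IntegralClosureFinite

/-! ### The lattice `R` in `K_∞` -/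

section Lattice

variable {k K : Type*} [Field k] [Field K] [Algebra (RatFunc k) K]

/-- The coordinates of `K_∞` with respect to a basis of `K`. -/
def coordEquiv {ι : Type*} [Finite ι] [DecidableEq ι] (b : Module.Basis ι (RatFunc k) K) :
    (K ⊗[RatFunc k] LocalInfty k) ≃ₗ[LocalInfty k] (ι → LocalInfty k) :=
  let e := (TensorProduct.equivFinsuppOfBasisLeft (N := LocalInfty k) b).trans
    (Finsupp.linearEquivFunOnFinite (RatFunc k) (LocalInfty k) ι)
  { e with
    map_smul' := fun c z ↦ by
      change e (c • z) = c • e z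
      rw [Algebra.smul_def, algebraMap_tensor_apply]
      induction z with
      | zero => simp
      | add x y hx hy => rw [mul_add, map_add, hx, hy, map_add, smul_add]
      | tmul x y =>
        ext i
        simp [e, Algebra.smul_def, mul_left_comm] }

lemma coordEquiv_tmul {ι : Type*} [Finite ι] [DecidableEq ι] (b : Module.Basis ι (RatFunc k) K)
    (x : K) (y : LocalInfty k) (i : ι) :
    coordEquiv b (x ⊗ₜ y) i = algebraMap (RatFunc k) (LocalInfty k) (b.repr x i) * y := by
  rw [← Algebra.smul_def]
  exact TensorProduct.equivFinsuppOfBasisLeft_apply_tmul_apply b x y i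

variable [FiniteDimensional (RatFunc k) K]

lemma continuous_coordEquiv {ι : Type*} [Finite ι] [DecidableEq ι]
    (b : Module.Basis ι (RatFunc k) K) : Continuous (coordEquiv b) := by
  have := Fintype.ofFinite ι
  exact LinearMap.continuous_of_finiteDimensional (coordEquiv b).toLinearMap

lemma continuous_coordEquiv_symm {ι : Type*} [Finite ι] [DecidableEq ι]
    (b : Module.Basis ι (RatFunc k) K) : Continuous (coordEquiv b).symm := by
  have := Fintype.ofFinite ι
  exact LinearMap.continuous_of_finiteDimensional (coordEquiv b).symm.toLinearMap

variable [Finite k] [Algebra k[X] K] [IsScalarTower k[X] (RatFunc k) K] {R : Type*} [CommRing R]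
  [Algebra k[X] R] [Algebra R K] [IsScalarTower k[X] R K] [IsIntegralClosure R k[X] K]

variable (k K R) in
/-- The image of `R` in `K_∞` is discrete: its coordinates are polynomials up to a common
denominator, and nonzero polynomials have absolute value at least `1`. -/
lemma exists_nhds_zero_tmul_one_eq_zero :
    ∃ U ∈ nhds (0 : K ⊗[RatFunc k] LocalInfty k), ∀ r : R,
      (algebraMap R K r ⊗ₜ 1 : K ⊗[RatFunc k] LocalInfty k) ∈ U → r = 0 := by
  let b := Module.finBasis (RatFunc k) K
  obtain ⟨d, hd, h⟩ := exists_common_denominator (R := R) b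
  have hd0 : 0 < ‖polyToLocal k d‖ := by
    rw [norm_polyToLocal hd]
    positivity
  refine ⟨coordEquiv b ⁻¹' Metric.ball 0 ‖polyToLocal k d‖⁻¹,
    (continuous_coordEquiv b).continuousAt.preimage_mem_nhds ?_, fun r hr ↦ ?_⟩
  · rw [map_zero]
    exact Metric.ball_mem_nhds 0 (inv_pos.mpr hd0)
  · have hr0 : algebraMap R K r = 0 := by
      refine b.repr.map_eq_zero_iff.mp (Finsupp.ext fun i ↦ ?_)
      obtain ⟨g, hg⟩ := h r i
      have h1 : ‖coordEquiv b (algebraMap R K r ⊗ₜ 1) i‖ < ‖polyToLocal k d‖⁻¹ :=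
        (norm_le_pi_norm _ i).trans_lt (mem_ball_zero_iff.mp hr)
      rw [coordEquiv_tmul, mul_one] at h1
      have h2 : polyToLocal k g = polyToLocal k d *
          algebraMap (RatFunc k) (LocalInfty k) (b.repr (algebraMap R K r) i) := by
        rw [polyToLocal, RingHom.comp_apply, ← hg, map_mul]
        rfl
      have h3 : g = 0 := by
        refine eq_zero_of_norm_polyToLocal_lt_one ?_
        rw [h2, norm_mul, mul_comm]
        exact (lt_inv_mul_iff₀' hd0).mp (by simpa using h1)
      rw [h3, map_zero, mul_eq_zero] at hg
      exact hg.resolve_left (by simpa using hd)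
    exact IsIntegralClosure.algebraMap_injective R k[X] K (hr0.trans (map_zero _).symm)

variable (k K R) in
/-- The image of `R` in `K_∞` is co-compact: it contains a basis of `K`, and the coordinates may be
reduced modulo their polynomial parts. -/
lemma exists_isCompact_tmul_one_add :
    ∃ Ω : Set (K ⊗[RatFunc k] LocalInfty k), IsCompact Ω ∧ ∀ z, ∃ r : R,
      z - (algebraMap R K r ⊗ₜ 1 : K ⊗[RatFunc k] LocalInfty k) ∈ Ω := by
  classical
  obtain ⟨s, b, hb⟩ := FiniteDimensional.exists_is_basis_integral k[X] (RatFunc k) K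
  have hb' (i : s) : ∃ r : R, algebraMap R K r = b i :=
    IsIntegralClosure.isIntegral_iff.mp (hb i)
  choose r hr using hb'
  refine ⟨(coordEquiv b).symm '' Metric.closedBall 0 1,
    (isCompact_closedBall _ _).image (continuous_coordEquiv_symm b), fun z ↦ ?_⟩
  choose g hg using fun i ↦ exists_norm_sub_polyToLocal_lt_one (coordEquiv b z i)
  refine ⟨∑ i, g i • r i, coordEquiv b (z - _), ?_, LinearEquiv.symm_apply_apply _ _⟩
  rw [mem_closedBall_zero_iff, pi_norm_le_iff_of_nonneg zero_le_one]
  intro i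
  have h1 : algebraMap R K (∑ i, g i • r i) =
      ∑ i, algebraMap k[X] (RatFunc k) (g i) • b i := by
    rw [map_sum]
    refine Finset.sum_congr rfl fun i _ ↦ ?_
    rw [Algebra.smul_def, map_mul, hr, ← IsScalarTower.algebraMap_apply,
      IsScalarTower.algebraMap_apply k[X] (RatFunc k) K, ← Algebra.smul_def]
  rw [map_sub, Pi.sub_apply, coordEquiv_tmul, mul_one, h1, b.repr_sum_self]
  exact (hg i).le

end Lattice

/-! ### Discrete and co-compact subgroups -/

section Subgroups

variable {A : Type*} [AddCommGroup A] [TopologicalSpace A] [IsTopologicalAddGroup A]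

lemma discreteTopology_of_nhds_zero (Λ : AddSubgroup A) {U : Set A} (hU : U ∈ nhds 0)
    (h : ∀ x ∈ Λ, x ∈ U → x = 0) : DiscreteTopology Λ := by
  refine discreteTopology_of_isOpen_singleton_zero ?_
  refine isOpen_singleton_iff_nhds_eq_pure _ |>.mpr (le_antisymm ?_ (pure_le_nhds _))
  rw [Filter.le_pure_iff]
  have h1 : ((↑) : Λ → A) ⁻¹' U ∈ nhds (0 : Λ) :=
    continuous_subtype_val.continuousAt.preimage_mem_nhds hU
  exact Filter.mem_of_superset h1 fun x hx ↦ Subtype.ext (h x x.2 hx)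

/-- If `f` is an endomorphism which is open at `0` and `N` is a co-compact subgroup, then
`f⁻¹(N)` is co-compact as well: `f(A) + N` is open, hence closed. -/
lemma exists_isCompact_comap [WeaklyLocallyCompactSpace A] (f : A →+ A)
    (hf : ∀ U ∈ nhds (0 : A), f '' U ∈ nhds (0 : A)) (N : AddSubgroup A) {Ω : Set A}
    (hΩ : IsCompact Ω) (h : ∀ z, ∃ r ∈ N, z - r ∈ Ω) :
    ∃ Ω' : Set A, IsCompact Ω' ∧ ∀ z, ∃ x, f x ∈ N ∧ z - x ∈ Ω' := by
  obtain ⟨W, hW, hW0⟩ := exists_compact_mem_nhds (0 : A)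
  let V : AddSubgroup A := f.range ⊔ N
  have hVo : IsOpen (V : Set A) := by
    refine V.isOpen_of_mem_nhds (g := 0) (Filter.mem_of_superset (hf W hW0) ?_)
    rintro _ ⟨w, -, rfl⟩
    exact AddSubgroup.mem_sup_left ⟨w, rfl⟩
  have hVΩ : IsCompact (Ω ∩ V) := hΩ.inter_right (V.isClosed_of_isOpen hVo)
  have hV (v : A) : ∃ y, v ∈ V → v - f y ∈ N := by
    by_cases hv : v ∈ V
    · obtain ⟨_, ⟨y, rfl⟩, r, hr, rfl⟩ := AddSubgroup.mem_sup.mp hv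
      exact ⟨y, fun _ ↦ by simpa using hr⟩
    · exact ⟨0, fun h ↦ absurd h hv⟩
  choose y hy using hV
  obtain ⟨T, hT, hcov⟩ := hVΩ.elim_nhds_subcover (fun v ↦ (fun a ↦ a - v) ⁻¹' (f '' W))
    fun v _ ↦ by
      refine (continuous_id.sub continuous_const).continuousAt.preimage_mem_nhds ?_
      simpa using hf W hW0
  refine ⟨⋃ v ∈ T, (fun a ↦ y v + a) '' W,
    T.isCompact_biUnion fun v _ ↦ hW.image (continuous_const.add continuous_id), fun z ↦ ?_⟩
  obtain ⟨r, hr, hrz⟩ := h (f z)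
  have hmem : f z - r ∈ V :=
    V.sub_mem (AddSubgroup.mem_sup_left ⟨z, rfl⟩) (AddSubgroup.mem_sup_right hr)
  obtain ⟨v, hv, w, hw, hwv⟩ := Set.mem_iUnion₂.mp (hcov ⟨hrz, hmem⟩)
  refine ⟨z - (y v + w), ?_, Set.mem_biUnion hv ⟨w, hw, (sub_sub_cancel _ _).symm⟩⟩
  have h1 : f (z - (y v + w)) = r + (v - f (y v)) := by
    have h2 : f w = f z - r - v := hwv
    rw [map_sub, map_add, h2]
    abel
  rw [h1]
  exact N.add_mem hr (hy v (hT v hv).2)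

end Subgroups

section FG

variable {k V : Type*} [Field k] [NormedAddCommGroup V] [NormedSpace (LocalInfty k) V]
  [ProperSpace V] [Module k[X] V]

/-- A discrete and co-compact `k[t]`-lattice is generated by its elements in a sufficiently large
ball: an element `x` of the lattice is congruent to a shorter one modulo a small element, obtained
by approximating `x / t` by the lattice. -/
lemma fg_of_discreteTopology (hX : ∀ v : V, (X : k[X]) • v = polyToLocal k X • v)
    (Λ : Submodule k[X] V) [DiscreteTopology Λ] {r : ℝ} (hΛ : ∀ v, ∃ x ∈ Λ, ‖v - x‖ ≤ r) :
    Λ.FG := by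
  have hr : 0 ≤ r := by
    obtain ⟨x, -, hx⟩ := hΛ 0
    exact (norm_nonneg _).trans hx
  have ht : ‖polyToLocal k X‖ = 2 := norm_polyToLocal_X
  have ht0 : polyToLocal k X ≠ 0 := norm_ne_zero_iff.mp (by rw [ht]; exact two_ne_zero)
  let S : Set V := (Λ : Set V) ∩ Metric.closedBall 0 (4 * (r + 1))
  have hS : S.Finite := by
    have : DiscreteTopology Λ.toAddSubgroup := inferInstanceAs (DiscreteTopology Λ)
    have hcl : IsClosed (Λ.toAddSubgroup : Set V) := AddSubgroup.isClosed_of_discrete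
    have hc : IsCompact S := (isCompact_closedBall (0 : V) (4 * (r + 1))).inter_left hcl
    have hd : DiscreteTopology S := DiscreteTopology.of_subset (s := (Λ : Set V)) ‹_›
      Set.inter_subset_left
    exact hc.finite ⟨hd⟩
  have hle : Submodule.span k[X] S ≤ Λ := Submodule.span_le.mpr Set.inter_subset_left
  have key (n : ℕ) (x : V) (hx : x ∈ Λ) (hn : ‖x‖ ≤ 4 * (r + 1) * (4 / 3) ^ n) :
      x ∈ Submodule.span k[X] S := by
    induction n generalizing x with
    | zero => exact Submodule.subset_span ⟨hx, by simpa using hn⟩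
    | succ n ih =>
      by_cases hsmall : ‖x‖ ≤ 4 * (r + 1)
      · exact Submodule.subset_span ⟨hx, by simpa using hsmall⟩
      obtain ⟨y, hy, hxy⟩ := hΛ ((polyToLocal k X)⁻¹ • x)
      have h1 : x - (X : k[X]) • y = polyToLocal k X • ((polyToLocal k X)⁻¹ • x - y) := by
        rw [hX, smul_sub, smul_inv_smul₀ ht0]
      have h2 : x - (X : k[X]) • y ∈ Submodule.span k[X] S := by
        refine Submodule.subset_span ⟨Λ.sub_mem hx (Λ.smul_mem _ hy), ?_⟩
        rw [mem_closedBall_zero_iff, h1, norm_smul, ht]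
        linarith
      have h3 : ‖y‖ ≤ 1 / 2 * ‖x‖ + r := by
        have h4 : y = (polyToLocal k X)⁻¹ • x - ((polyToLocal k X)⁻¹ • x - y) := by abel
        rw [h4]
        refine (norm_sub_le _ _).trans (add_le_add ?_ hxy)
        rw [norm_smul, norm_inv, ht, one_div]
      have h5 : y ∈ Submodule.span k[X] S := by
        refine ih y hy ?_
        rw [pow_succ, ← mul_assoc] at hn
        linarith [not_le.mp hsmall]
      rw [← sub_add_cancel x ((X : k[X]) • y)]
      exact Submodule.add_mem _ h2 (Submodule.smul_mem _ _ h5)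
  refine ⟨hS.toFinset, le_antisymm (by simpa using hle) fun x hx ↦ ?_⟩
  obtain ⟨n, hn⟩ := pow_unbounded_of_one_lt (‖x‖ / (4 * (r + 1))) (show (1 : ℝ) < 4 / 3 by norm_num)
  rw [Set.Finite.coe_toFinset]
  refine key n x hx ?_
  rw [div_lt_iff₀ (by positivity)] at hn
  linarith

end FG

/-! ### The lattice of logarithms of integral points -/

section UnitLattice

variable {k R K : Type*} [Field k] [Fintype k] [CommRing R] [Algebra k[X] R]
  [Field K] [Algebra k[X] K] [Algebra (RatFunc k) K] [FiniteDimensional (RatFunc k) K]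
  [IsScalarTower k[X] (RatFunc k) K] [Algebra R K] [IsScalarTower k[X] R K]
  (E : DrinfeldModel k R)

omit [FiniteDimensional (RatFunc k) K] [Fintype k] in
lemma poly_smul_eq_polyToLocal_smul (p : k[X]) (z : K ⊗[RatFunc k] LocalInfty k) :
    p • z = polyToLocal k p • z := by
  have h := algebraMap_poly_eq_polyToLocal (K := K) (B := K ⊗[RatFunc k] LocalInfty k) p
  rw [Algebra.smul_def, Algebra.smul_def, ← h, ← IsScalarTower.algebraMap_apply]

variable {f : K ⊗[RatFunc k] LocalInfty k →+ K ⊗[RatFunc k] LocalInfty k}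

/-- An element `r` of `R` is regarded as the element `r ⊗ 1` of `K_∞`. -/
lemma mem_unitLattice_iff (hf : E.IsExpOn K f) (x : K ⊗[RatFunc k] LocalInfty k) :
    x ∈ E.unitLattice K ↔ ∃ r : R, algebraMap R K r ⊗ₜ 1 = f x := by
  rw [DrinfeldModel.unitLattice, DrinfeldModel.mem_expPreimage]
  constructor
  · rintro ⟨y, hy, r, hr⟩
    obtain rfl := hy.unique (hf.hasExp x)
    exact ⟨E.toPoints.symm r, congrArg E.toPoints.symm hr⟩
  · rintro ⟨r, hr⟩
    exact ⟨f x, hf.hasExp x, E.toPoints r, congrArg E.toPoints hr⟩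

variable [IsIntegralClosure R k[X] K]

lemma discreteTopology_unitLattice (hf : E.IsExpOn K f) : DiscreteTopology (E.unitLattice K) := by
  obtain ⟨U, hU, hU0⟩ := exists_nhds_zero_tmul_one_eq_zero k K R
  obtain ⟨W, hW, hW0⟩ := hf.exists_injOn
  refine discreteTopology_of_nhds_zero (E.unitLattice K).toAddSubgroup (U := W ∩ f ⁻¹' U)
    (Filter.inter_mem hW (hf.continuous.continuousAt.preimage_mem_nhds (by rwa [map_zero]))) ?_
  rintro x hx ⟨hxW, hxU⟩
  obtain ⟨r, hr⟩ := (mem_unitLattice_iff E hf x).mp hx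
  refine hW0 x hxW ?_
  rw [← hr, hU0 r (hr ▸ hxU), map_zero, TensorProduct.zero_tmul]

lemma exists_isCompact_unitLattice (hf : E.IsExpOn K f) :
    ∃ Ω : Set (K ⊗[RatFunc k] LocalInfty k), IsCompact Ω ∧
      ∀ z, ∃ x ∈ E.unitLattice K, z - x ∈ Ω := by
  have : LocallyCompactSpace (K ⊗[RatFunc k] LocalInfty k) :=
    LocallyCompactSpace.of_finiteDimensional_of_complete (LocalInfty k) _
  obtain ⟨Ω, hΩ, h⟩ := exists_isCompact_tmul_one_add k K R
  let N : AddSubgroup (K ⊗[RatFunc k] LocalInfty k) :=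
    ((algebraMap K (K ⊗[RatFunc k] LocalInfty k)).comp (algebraMap R K)).toAddMonoidHom.range
  obtain ⟨Ω', hΩ', h'⟩ := exists_isCompact_comap f hf.image_mem_nhds N hΩ fun z ↦ by
    obtain ⟨r, hr⟩ := h z
    exact ⟨_, ⟨r, rfl⟩, hr⟩
  refine ⟨Ω', hΩ', fun z ↦ ?_⟩
  obtain ⟨x, ⟨r, hr⟩, hx⟩ := h' z
  exact ⟨x, (mem_unitLattice_iff E hf x).mpr ⟨r, hr⟩, hx⟩

lemma compactSpace_quotient_unitLattice (hf : E.IsExpOn K f) :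
    CompactSpace ((K ⊗[RatFunc k] LocalInfty k) ⧸ E.unitLattice K) := by
  obtain ⟨Ω, hΩ, h⟩ := exists_isCompact_unitLattice E hf
  have h1 : IsCompact ((E.unitLattice K).mkQ '' Ω) := hΩ.image continuous_quotient_mk'
  refine ⟨h1.of_isClosed_subset isClosed_univ fun q _ ↦ ?_⟩
  obtain ⟨z, rfl⟩ := (E.unitLattice K).mkQ_surjective q
  obtain ⟨x, hx, hxz⟩ := h z
  refine ⟨z - x, hxz, ?_⟩
  have hx0 : (E.unitLattice K).mkQ x = 0 := (Submodule.Quotient.mk_eq_zero _).mpr hx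
  rw [map_sub, hx0, sub_zero]

lemma fg_unitLattice (hf : E.IsExpOn K f) : (E.unitLattice K).FG := by
  classical
  let e := coordEquiv (Module.finBasis (RatFunc k) K)
  let V := Fin (Module.finrank (RatFunc k) K) → LocalInfty k
  let _ : Module k[X] V := Module.compHom V (polyToLocal k)
  let e' : (K ⊗[RatFunc k] LocalInfty k) ≃ₗ[k[X]] V :=
    { e with
      map_smul' := fun p z ↦ by
        change e (p • z) = polyToLocal k p • e z
        rw [← e.map_smul, poly_smul_eq_polyToLocal_smul] }
  have hd := discreteTopology_unitLattice E hf
  obtain ⟨Ω, hΩ, h⟩ := exists_isCompact_unitLattice E hf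
  obtain ⟨r, hr⟩ := hΩ.exists_bound_of_continuousOn
    (continuous_coordEquiv (Module.finBasis (RatFunc k) K)).continuousOn
  let Λ := (E.unitLattice K).map e'.toLinearMap
  have hmem (v : V) : v ∈ Λ → e.symm v ∈ E.unitLattice K := by
    rintro ⟨x, hx, rfl⟩
    exact (e.symm_apply_apply x).symm ▸ hx
  have hΛ : DiscreteTopology Λ := by
    let j : Λ → E.unitLattice K := fun v ↦ ⟨e.symm v, hmem v v.2⟩
    have hj : Continuous j := by
      refine Continuous.subtype_mk ?_ _
      exact (continuous_coordEquiv_symm _).comp continuous_subtype_val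
    refine DiscreteTopology.of_continuous_injective hj fun v w hvw ↦ Subtype.ext ?_
    exact e.symm.injective (congrArg Subtype.val hvw)
  have hfg : Λ.FG := by
    refine fg_of_discreteTopology (k := k) (V := V) (fun v ↦ rfl) Λ (r := r) fun v ↦ ?_
    obtain ⟨x, hx, hxv⟩ := h (e.symm v)
    refine ⟨e x, ⟨x, hx, rfl⟩, ?_⟩
    have h1 : ‖e (e.symm v - x)‖ ≤ r := hr _ hxv
    rwa [map_sub, e.apply_symm_apply] at h1
  exact Submodule.fg_of_fg_map_injective e'.toLinearMap e'.injective hfg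

end UnitLattice

/-! ### The connecting homomorphism -/

section Connecting

variable {k R K L : Type*} [Field k] [Fintype k] [CommRing R] [Algebra k[X] R]
  [Field K] [Algebra k[X] K] [Algebra (RatFunc k) K] [IsScalarTower k[X] (RatFunc k) K]
  [FiniteDimensional (RatFunc k) K] [Algebra R K] [IsScalarTower k[X] R K]
  [Field L] [Algebra (LocalInfty k) L] [Algebra (RatFunc k) L]
  [IsScalarTower (RatFunc k) (LocalInfty k) L]

omit [Fintype k] [Algebra k[X] K] [IsScalarTower k[X] (RatFunc k) K]
  [FiniteDimensional (RatFunc k) K] in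
lemma galAct_fromLocal (σ : Gal(L/LocalInfty k)) (x : K ⊗[RatFunc k] LocalInfty k) :
    galAct K σ (fromLocal K L x) = fromLocal K L x := by
  induction x with
  | zero => simp
  | add x y hx hy => rw [map_add, map_add, hx, hy]
  | tmul x y => exact congrArg (fun z ↦ x ⊗ₜ z) (σ.commutes y)

variable [Algebra.IsAlgebraic (LocalInfty k) L] (E : DrinfeldModel k R)

variable (K L) in
/-- The `k[t]`-module of the pairs `(y, x)` in `Lie_E(K ⊗ L) × E(K_∞)` with `exp_E(y) = x`. -/
def logPairs : Submodule k[X] ((K ⊗[RatFunc k] L) × E.Points (K ⊗[RatFunc k] LocalInfty k)) :=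
  (E.expGraph K (K ⊗[RatFunc k] L)).comap
    (LinearMap.prodMap LinearMap.id (E.pointsMap ((fromLocal K L).restrictScalars R)))

lemma galAct_sub_mem_periodLattice {y : K ⊗[RatFunc k] L} {x : K ⊗[RatFunc k] LocalInfty k}
    (h : E.HasExp K y (fromLocal K L x)) (σ : Gal(L/LocalInfty k)) :
    galAct K σ y - y ∈ E.periodLattice K L := by
  have h1 : E.HasExp K (galAct K σ y) (fromLocal K L x) := by
    have h2 := DrinfeldModel.HasExp.map_galAct E h σ
    rwa [galAct_fromLocal] at h2
  have h3 : (galAct K σ y - y, E.toPoints (fromLocal K L x) - E.toPoints (fromLocal K L x)) ∈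
      E.expGraph K (K ⊗[RatFunc k] L) :=
    (E.expGraph K (K ⊗[RatFunc k] L)).sub_mem
      (x := (galAct K σ y, E.toPoints (fromLocal K L x))) (y := (y, E.toPoints (fromLocal K L x)))
      h1 h
  rwa [sub_self] at h3

/-- The cocycle `σ ↦ σ(y) - y` of a pair `(y, x)` with `exp_E(y) = x`. -/
def logCocycle : logPairs K L E →ₗ[k[X]]
    contCocycles₁ k[X] Gal(L/LocalInfty k) (E.periodLattice K L) where
  toFun g := ⟨fun σ ↦ ⟨galAct K σ g.1.1 - g.1.1, galAct_sub_mem_periodLattice E g.2 σ⟩,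
    Continuous.subtype_mk (continuous_galAct_sub g.1.1) _, fun σ τ ↦ Subtype.ext <| by
      change galAct K (σ * τ) g.1.1 - g.1.1 =
        galAct K σ g.1.1 - g.1.1 + galAct K σ (galAct K τ g.1.1 - g.1.1)
      rw [galAct_mul, map_sub]
      abel⟩
  map_add' g h := Subtype.ext <| funext fun σ ↦ Subtype.ext <| by
    change galAct K σ (g.1.1 + h.1.1) - (g.1.1 + h.1.1) =
      galAct K σ g.1.1 - g.1.1 + (galAct K σ h.1.1 - h.1.1)
    rw [map_add]
    abel
  map_smul' p g := Subtype.ext <| funext fun σ ↦ Subtype.ext <| by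
    change galAct K σ (p • g.1.1) - p • g.1.1 = p • (galAct K σ g.1.1 - g.1.1)
    rw [smul_sub, ← IsScalarTower.algebraMap_smul K p g.1.1, map_smul,
      IsScalarTower.algebraMap_smul]

/-- If `exp_E` is surjective on `K ⊗ L`, then the classes of the cocycles `σ ↦ σ(y) - y` define the
connecting homomorphism. -/
lemma exists_isConnectingHom
    (hsurj : ∀ x : K ⊗[RatFunc k] L, ∃ y, E.HasExp K y x) :
    ∃ δ : E.Points (K ⊗[RatFunc k] LocalInfty k) →ₗ[k[X]] E.H1 K L, E.IsConnectingHom δ := by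
  let p : logPairs K L E →ₗ[k[X]] E.Points (K ⊗[RatFunc k] LocalInfty k) :=
    LinearMap.snd k[X] _ _ ∘ₗ (logPairs K L E).subtype
  let c : logPairs K L E →ₗ[k[X]] E.H1 K L := (Submodule.mkQ _) ∘ₗ logCocycle E
  have hp : Function.Surjective p := fun x ↦ by
    obtain ⟨y, hy⟩ := hsurj (fromLocal K L (E.toPoints.symm x))
    exact ⟨⟨(y, x), hy⟩, rfl⟩
  have hker : LinearMap.ker p ≤ LinearMap.ker c := by
    rintro ⟨⟨y, x⟩, hy⟩ (hx : x = 0)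
    subst hx
    have hy0 : E.HasExp K y (fromLocal K L 0) := hy
    rw [map_zero] at hy0
    exact (Submodule.Quotient.mk_eq_zero _).mpr ⟨⟨y, hy0⟩, fun σ ↦ rfl⟩
  let δ := (LinearMap.ker p).liftQ c hker ∘ₗ (p.quotKerEquivOfSurjective hp).symm.toLinearMap
  refine ⟨δ, fun x y hxy ↦ ⟨logCocycle E ⟨(y, E.toPoints x), hxy⟩, fun σ ↦ rfl, ?_⟩⟩
  have h1 : (p.quotKerEquivOfSurjective hp).symm (E.toPoints x) =
      Submodule.Quotient.mk ⟨(y, E.toPoints x), hxy⟩ := by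
    rw [LinearEquiv.symm_apply_eq]
    rfl
  change (LinearMap.ker p).liftQ c hker ((p.quotKerEquivOfSurjective hp).symm (E.toPoints x)) = _
  rw [h1]
  rfl

lemma contCocycles_ext {c c' : contCocycles₁ k[X] Gal(L/LocalInfty k) (E.periodLattice K L)}
    (h : ∀ σ, (c.1 σ : K ⊗[RatFunc k] L) = c'.1 σ) : c = c' :=
  Subtype.ext <| funext fun σ ↦ Subtype.ext (h σ)

lemma isConnectingHom_unique (hsurj : ∀ x : K ⊗[RatFunc k] L, ∃ y, E.HasExp K y x)
    {δ δ' : E.Points (K ⊗[RatFunc k] LocalInfty k) →ₗ[k[X]] E.H1 K L}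
    (h : E.IsConnectingHom δ) (h' : E.IsConnectingHom δ') : δ' = δ := by
  refine LinearMap.ext fun x ↦ ?_
  obtain ⟨y, hy⟩ := hsurj (fromLocal K L (E.toPoints.symm x))
  obtain ⟨c, hc, hδ⟩ := h _ y hy
  obtain ⟨c', hc', hδ'⟩ := h' _ y hy
  have hcc : c = c' := contCocycles_ext E fun σ ↦ (hc σ).trans (hc' σ).symm
  refine Eq.trans hδ' (Eq.trans ?_ hδ.symm)
  exact congrArg _ hcc.symm

/-- The kernel of the connecting homomorphism is the image of the exponential of `K_∞`: if the
cocycle of `y` is a coboundary, then `y` may be changed by a period to become Galois invariant. -/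
lemma isConnectingHom_eq_zero_iff [IsGalois (LocalInfty k) L]
    (hsurj : ∀ x : K ⊗[RatFunc k] L, ∃ y, E.HasExp K y x)
    {f : K ⊗[RatFunc k] LocalInfty k →+ K ⊗[RatFunc k] LocalInfty k} (hf : E.IsExpOn K f)
    {δ : E.Points (K ⊗[RatFunc k] LocalInfty k) →ₗ[k[X]] E.H1 K L}
    (h : E.IsConnectingHom δ) (x : K ⊗[RatFunc k] LocalInfty k) :
    δ (E.toPoints x) = 0 ↔ ∃ x₀, f x₀ = x := by
  have hmap (x₀ : K ⊗[RatFunc k] LocalInfty k) :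
      E.HasExp K (fromLocal K L x₀) (fromLocal K L (f x₀)) := by
    have h1 := HasSum.map (hf.hasExp x₀) (fromLocal K L) continuous_fromLocal
    refine h1.congr_fun fun i ↦ ?_
    simp only [Function.comp_apply, map_mul, map_pow, AlgHom.commutes]
  constructor
  · intro hx
    obtain ⟨y, hy⟩ := hsurj (fromLocal K L x)
    obtain ⟨c, hc, hδ⟩ := h x y hy
    rw [hx, eq_comm, Submodule.Quotient.mk_eq_zero] at hδ
    obtain ⟨m, hm⟩ := hδ
    obtain ⟨x₀, hx₀⟩ := exists_fromLocal_eq_of_galAct_eq (y - (m : K ⊗[RatFunc k] L)) fun σ ↦ by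
      have h1 : galAct K σ y - y = galAct K σ m - m :=
        (hc σ).symm.trans (congrArg Subtype.val (hm σ))
      rw [map_sub, sub_eq_sub_iff_sub_eq_sub]
      exact h1
    have h2 : E.HasExp K (y - (m : K ⊗[RatFunc k] L)) (fromLocal K L x) := by
      have h3 := (E.expGraph K (K ⊗[RatFunc k] L)).sub_mem
        (x := (y, E.toPoints (fromLocal K L x))) (y := (m, E.toPoints 0)) hy m.2
      rwa [map_zero, Prod.mk_sub_mk, sub_zero] at h3
    rw [← hx₀] at h2
    exact ⟨x₀, fromLocal_injective ((hmap x₀).unique h2)⟩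
  · rintro ⟨x₀, rfl⟩
    obtain ⟨c, hc, hδ⟩ := h (f x₀) (fromLocal K L x₀) (hmap x₀)
    have hc0 : c = 0 := Subtype.ext <| funext fun σ ↦ Subtype.ext <| by
      rw [hc σ, galAct_fromLocal, sub_self]
      rfl
    rw [hδ, hc0, Submodule.Quotient.mk_zero]

set_option synthInstance.maxHeartbeats 200000 in
/-- The points of `E(R)` in the kernel of `δ` are those with a logarithm in `K_∞`. -/
lemma map_unitModule_eq_expImage [IsGalois (LocalInfty k) L]
    (hsurj : ∀ x : K ⊗[RatFunc k] L, ∃ y, E.HasExp K y x)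
    {f : K ⊗[RatFunc k] LocalInfty k →+ K ⊗[RatFunc k] LocalInfty k} (hf : E.IsExpOn K f)
    {δ : E.Points (K ⊗[RatFunc k] LocalInfty k) →ₗ[k[X]] E.H1 K L} (h : E.IsConnectingHom δ) :
    (E.unitModule δ).map (E.integralPoints K) =
      E.expImage K (K ⊗[RatFunc k] LocalInfty k) (E.unitLattice K) := by
  ext y
  obtain ⟨y, rfl⟩ := E.toPoints.surjective y
  rw [DrinfeldModel.mem_expImage]
  constructor
  · rintro ⟨r, hr, hry⟩
    have h1 : δ (E.toPoints y) = 0 := by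
      rw [← hry]
      exact hr
    obtain ⟨x, rfl⟩ := (isConnectingHom_eq_zero_iff E hsurj hf h y).mp h1
    exact ⟨x, (mem_unitLattice_iff E hf x).mpr ⟨E.toPoints.symm r, congrArg E.toPoints.symm hry⟩,
      hf.hasExp x⟩
  · rintro ⟨x, hx, hxy⟩
    obtain rfl := hxy.unique (hf.hasExp x)
    obtain ⟨r, hr⟩ := (mem_unitLattice_iff E hf x).mp hx
    have hr' : E.integralPoints K (E.toPoints r) = E.toPoints (f x) := congrArg E.toPoints hr
    refine ⟨E.toPoints r, ?_, hr'⟩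
    change δ (E.integralPoints K (E.toPoints r)) = 0
    rw [hr', isConnectingHom_eq_zero_iff E hsurj hf h]
    exact ⟨x, rfl⟩

end Connecting

/-! ### The module of units -/

section UnitModule

variable {k R K : Type*} [Field k] [Fintype k] [CommRing R] [Algebra k[X] R]
  [Field K] [Algebra k[X] K] [Algebra (RatFunc k) K] [IsScalarTower k[X] (RatFunc k) K]
  [FiniteDimensional (RatFunc k) K] [Algebra R K] [IsScalarTower k[X] R K]
  (E : DrinfeldModel k R)
  {f : K ⊗[RatFunc k] LocalInfty k →+ K ⊗[RatFunc k] LocalInfty k}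

lemma fg_expImage (hf : E.IsExpOn K f) {M : Submodule k[X] (K ⊗[RatFunc k] LocalInfty k)}
    (hM : M.FG) : (E.expImage K (K ⊗[RatFunc k] LocalInfty k) M).FG := by
  let F : (K ⊗[RatFunc k] LocalInfty k) →ₗ[k[X]] E.Points (K ⊗[RatFunc k] LocalInfty k) :=
    { toFun x := E.toPoints (f x)
      map_add' x y := by simp
      map_smul' p x := by
        have h := (E.expGraph K (K ⊗[RatFunc k] LocalInfty k)).smul_mem p
          (x := (x, E.toPoints (f x))) (hf.hasExp x)
        exact congrArg E.toPoints ((hf.hasExp (p • x)).unique h) }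
  have h : E.expImage K (K ⊗[RatFunc k] LocalInfty k) M = M.map F := by
    ext y
    obtain ⟨y, rfl⟩ := E.toPoints.surjective y
    rw [DrinfeldModel.mem_expImage]
    constructor
    · rintro ⟨x, hx, hxy⟩
      exact ⟨x, hx, congrArg E.toPoints ((hf.hasExp x).unique hxy)⟩
    · rintro ⟨x, hx, hxy⟩
      exact ⟨x, hx, E.toPoints.injective hxy ▸ hf.hasExp x⟩
  rw [h]
  exact hM.map F

variable [IsIntegralClosure R k[X] K]

omit [IsScalarTower k[X] (RatFunc k) K] [IsScalarTower k[X] R K] in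
lemma integralPoints_injective : Function.Injective (E.integralPoints K) := by
  intro r s h
  have h1 : algebraMap K (K ⊗[RatFunc k] LocalInfty k) (algebraMap R K r) =
      algebraMap K (K ⊗[RatFunc k] LocalInfty k) (algebraMap R K s) := h
  exact IsIntegralClosure.algebraMap_injective R k[X] K
    ((algebraMap K (K ⊗[RatFunc k] LocalInfty k)).injective h1)

end UnitModule

end DrinfeldUnit

end

theorem mainTheorem2 {k : Type*} [Field k] [Fintype k]
    {K : Type*} [Field K] [Algebra k[X] K] [Algebra (RatFunc k) K]
    [IsScalarTower k[X] (RatFunc k) K] [FiniteDimensional (RatFunc k) K]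
    {R : Type*} [CommRing R] [Algebra k[X] R] [Algebra R K] [IsScalarTower k[X] R K]
    [IsIntegralClosure R k[X] K]
    {L : Type*} [Field L] [Algebra (DrinfeldUnit.LocalInfty k) L]
    [IsSepClosure (DrinfeldUnit.LocalInfty k) L] [Algebra (RatFunc k) L]
    [IsScalarTower (RatFunc k) (DrinfeldUnit.LocalInfty k) L]
    (E : DrinfeldUnit.DrinfeldModel k R) :
    ∃ δ : E.Points (K ⊗[RatFunc k] DrinfeldUnit.LocalInfty k) →ₗ[k[X]] E.H1 K L,
      E.IsConnectingHom δ ∧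
      (∀ δ' : E.Points (K ⊗[RatFunc k] DrinfeldUnit.LocalInfty k) →ₗ[k[X]] E.H1 K L,
        E.IsConnectingHom δ' → δ' = δ) ∧
      (E.unitModule δ).FG ∧
      (E.unitModule δ).map (E.integralPoints K) =
        E.expImage K (K ⊗[RatFunc k] DrinfeldUnit.LocalInfty k) (E.unitLattice K) ∧
      DiscreteTopology (E.unitLattice K) ∧
      CompactSpace ((K ⊗[RatFunc k] DrinfeldUnit.LocalInfty k) ⧸ E.unitLattice K) := by
  have hsep : IsSepClosed L := IsSepClosure.sep_closed (DrinfeldUnit.LocalInfty k)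
  have hgal : IsGalois (DrinfeldUnit.LocalInfty k) L := inferInstance
  let _ : Algebra L (K ⊗[RatFunc k] L) := Algebra.TensorProduct.rightAlgebra
  have hfin : Module.Finite L (K ⊗[RatFunc k] L) :=
    Module.Finite.equiv (Algebra.TensorProduct.commRight (RatFunc k) L K).toLinearEquiv
  have hsurj (x : K ⊗[RatFunc k] L) : ∃ y, E.HasExp K y x :=
    DrinfeldUnit.exists_hasExp_eq (L := L) E x
  obtain ⟨f, hf⟩ := DrinfeldUnit.exists_isExpOn (K := K)
    (A := K ⊗[RatFunc k] DrinfeldUnit.LocalInfty k) E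
  obtain ⟨δ, hδ⟩ := DrinfeldUnit.exists_isConnectingHom (L := L) E hsurj
  have himage := DrinfeldUnit.map_unitModule_eq_expImage E hsurj hf hδ
  refine ⟨δ, hδ, fun δ' hδ' ↦ DrinfeldUnit.isConnectingHom_unique E hsurj hδ hδ', ?_, himage,
    DrinfeldUnit.discreteTopology_unitLattice E hf,
    DrinfeldUnit.compactSpace_quotient_unitLattice E hf⟩
  refine Submodule.fg_of_fg_map_injective (E.integralPoints K)
    (DrinfeldUnit.integralPoints_injective E) ?_
  rw [himage]
  exact DrinfeldUnit.fg_expImage E hf (DrinfeldUnit.fg_unitLattice E hf)
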